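/- Let $N$ be a finite set of agents and $O$ a finite set of objects with $|N|=|O|=n$. Each agent $i$ has a strict preference order $R_i$ over $O$, and all strict orders are possible. An assignment rule $\varphi$ maps every preference profile $R=(R_i)_{i\in N}$ to a bijection $\varphi(R):N\to O$; write $\varphi_i(R)$ for the object assigned to $i$. A submatching $\sigma$ is a bijection between a subset of $N$ and a subset of $O$, and $\sigma\subseteq\sigma'$ means that $\sigma'$ extends $\sigma$. An ownership structure $c$ specifies, for every submatching $\sigma$ that leaves some agent unmatched and every object $x$ unassigned in $\sigma$, an agent $c_\sigma(x)$ unmatched in $\sigma$ (the owner of $x$ at $\sigma$), such that ownership persists: if $\sigma\subseteq\sigma'$, $c_\sigma(x)=i$, and $i$ and $x$ are both still unmatched in $\sigma'$, then $c_{\sigma'}(x)=i$. The trading-cycles mechanism (without brokers) of $c$ starts at the empty submatching and repeats the following round until all objects are assigned: every unmatched agent points to her most preferred unassigned object, every unassigned object points to its owner, and each agent on a cycle is assigned the object she points to. A hierarchical exchange rule is an assignment rule that is given by the trading-cycles mechanism of some ownership structure. An assignment rule is a Bi-polar Serial Dictatorship if it is given by the trading-cycles mechanism of an ownership structure $c$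 for which there is an ordering $i_1,\dots,i_n$ of the agents such that $c_\emptyset(x)\in\{i_1,i_2\}$ for all $x\in O$ (if $n=1$, $c_\emptyset(x)=i_1$) and, at every submatching $\sigma$ that leaves some agent unmatched and in which at least one of $i_1,i_2$ is matched, the first unmatched agent in the ordering owns all unassigned objects. For agents $i,j$ and preferences $R_{-i}$ of the agents other than $i$, the menu of $i$ for $j$ is $$\mathcal M^{\varphi}_{i|j}(R_{-i})=\{\varphi_j(R_i,R_{-i}) : R_i \text{ a strict order on } O\}.$$ **Theorem.** A hierarchical exchange rule $\varphi$ is a Bi-polar Serial Dictatorship if and only if $|\mathcal M^{\varphi}_{i|j}(R_{-i})|\le 2$ for all agents $i\neq j$ and all preference profiles $R$. -/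

import Mathlib

namespace Assignment

variable {N O : Type*}

/-- A profile of strict preferences over the objects: `(R i).le y x` means that agent `i` weakly
prefers `x` to `y`, so that the greatest object is the most preferred one. All strict orders are
admitted for every agent. -/
abbrev Profile (N O : Type*) := N → LinearOrder O

/-- An assignment rule maps each preference profile to a bijection from agents to objects. -/
abbrev Rule (N O : Type*) := Profile N O → N ≃ O

/-- A submatching is a bijection between a set of agents and a set of objects. Mathlib's `σ ≤ σ'`
says that `σ'` extends `σ`, and `⊥` is the empty submatching. -/
abbrev Submatching (N O : Type*) := N ≃. O

namespace Submatching

/-- Agent `i` is unmatched in `σ`. -/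
def FreeAgent (σ : Submatching N O) (i : N) : Prop := σ i = none

/-- Object `x` is unassigned in `σ`. -/
def FreeObject (σ : Submatching N O) (x : O) : Prop := σ.symm x = none

end Submatching

/-- A structure of control rights without brokers: at each proper submatching, each unassigned
object is owned by an unmatched agent, and ownership persists as long as the owner is unmatched and
the object is unassigned. The values of `owner σ` at objects assigned in `σ` have no meaning and
are never used. -/
structure OwnershipStructure (N O : Type*) where
  owner : Submatching N O → O → N
  owner_free : ∀ (σ : Submatching N O) (x : O), σ.FreeObject x → σ.FreeAgent (owner σ x)
  persistent : ∀ (σ σ' : Submatching N O) (x : O) (i : N), σ ≤ σ' → σ'.FreeObject x →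
    σ'.FreeAgent i → owner σ x = i → owner σ' x = i

/-- At `σ`, the unmatched agent `i` points to `x`, her most preferred unassigned object. -/
def PointsTo (R : Profile N O) (σ : Submatching N O) (i : N) (x : O) : Prop :=
  σ.FreeAgent i ∧ σ.FreeObject x ∧ ∀ y, σ.FreeObject y → (R i).le y x

namespace OwnershipStructure

variable (c : OwnershipStructure N O) (R : Profile N O)

/-- At `σ`, agent `i` points to an object that points to its owner `j`. -/
def PointsToOwner (σ : Submatching N O) (i j : N) : Prop :=
  ∃ x, PointsTo R σ i x ∧ c.owner σ x = j

/-- Agent `i` is on a trading cycle at `σ`. As every agent points to at most one other agent, a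
closed walk through `i` is a cycle (possibly repeated); all agents on a cycle are owners. -/
def InTradingCycle (σ : Submatching N O) (i : N) : Prop :=
  Relation.TransGen (c.PointsToOwner R σ) i i

/-- One round of the algorithm leads from `σ` to `σ'`: `σ'` extends `σ` by assigning to each agent
on a trading cycle the object that she points to. -/
def Round (σ σ' : Submatching N O) : Prop :=
  ∀ i x, x ∈ σ' i ↔ x ∈ σ i ∨ (c.InTradingCycle R σ i ∧ PointsTo R σ i x)

/-- `φ` is the rule of the trading-cycles mechanism of `c`: at each profile the algorithm, started
at the empty submatching, ends with the (complete) matching that `φ` selects. -/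
def Implements (φ : Rule N O) : Prop :=
  ∀ R : Profile N O, Relation.ReflTransGen (c.Round R) ⊥ (φ R).toPEquiv

/-- The ownership structure is bi-polar for the ordering `e 0, e 1, …` of the agents. Initially
each object is owned by one of the first two agents. As soon as one of these two is matched, the
first of all unmatched agents owns all unassigned objects. (No other nonempty submatching can arise
in the algorithm.) -/
def IsBipolar {n : ℕ} (c : OwnershipStructure N O) (e : Fin n ≃ N) : Prop :=
  (∀ x, (e.symm (c.owner ⊥ x)).val < 2) ∧
  ∀ σ : Submatching N O, (∃ m : Fin n, m.val < 2 ∧ ¬ σ.FreeAgent (e m)) →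
    ∀ x, σ.FreeObject x → ∀ k, σ.FreeAgent (e k) →
      ((∀ l, σ.FreeAgent (e l) → k ≤ l) ↔ c.owner σ x = e k)

end OwnershipStructure

namespace Rule

/-- Hierarchical exchange rules: the rules of trading-cycles mechanisms without brokers. -/
def IsHierarchicalExchange (φ : Rule N O) : Prop :=
  ∃ c : OwnershipStructure N O, c.Implements φ

/-- Bi-polar serial dictatorships. -/
def IsBipolarSerialDictatorship [Fintype N] (φ : Rule N O) : Prop :=
  ∃ (c : OwnershipStructure N O) (e : Fin (Fintype.card N) ≃ N), c.IsBipolar e ∧ c.Implements φ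

/-- Agent `i`'s menu for agent `j`, given the preferences in `R` of the agents other than `i`: the
objects that `j` can be assigned when `i`'s reported preferences vary. -/
def menu [DecidableEq N] (φ : Rule N O) (i j : N) (R : Profile N O) : Set O :=
  Set.range fun r : LinearOrder O => φ (Function.update R i r) j

end Rule

end Assignment

/-!
A trading-cycles outcome can be found with any sequence of exchanges along trading cycles, because
ownership persists (`Completes.after_exchange`, `implements_iff`). It is efficient
(`Completes.eq_of_forall_le`), and what happens after a submatching depends only on the
preferences of the unmatched agents over the unassigned objects (`Completes.congr_profile`).

*Bi-polar rules have small menus.* Each of the two poles gets the best object not taken by the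
other, and every later agent gets the best object not taken by her predecessors. So agents may be
thought of as choosing in turn, with `i` as the first agent if she is a pole. The agents before
`i` are not affected by her preferences. After the turn of `i` the set of objects taken consists
of a fixed set and one object that varies with her preferences; the next agent then takes the best
object outside the fixed set or, if that is the varying one, the runner-up, and either way the
objects taken are again a fixed set and one varying object (`exists_two_choices`). Hence every
agent has at most two possible assignments (`ncard_menu_le_two`).

*Small menus force a bi-polar rule.* Call a set `S` of agents dictating if its members get their
best objects whenever these are different (`Dictates`). Let `S` be dictating, `i` in `S`, and `j`,
`k` outside `S`. Let each agent other than these three have a top object of her own, which leaves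
three objects `x`, `y`, `z` to `i`, `j`, `k`. Agent `i` can choose any of the three. If `j` ranks
them `z, x, y` and `k` ranks them `z, y, x`, then `j` gets `x` when `i` takes `z`, by efficiency.
If `k` wins `z` when `i` takes `x`, then `j` is left with `y`, and she must not win `z` when `i`
takes `y`, for then the menu would be `{x, y, z}` (`wins_of_wins`). So the winner of a competition
does not depend on what `i` takes. It follows that after the departure of `S` all objects have the
same owner (`Dictates.not_two_owners`), who is independent of what the members of `S` took
(`Dictates.exists_owner`), and adding her to `S` gives a larger dictating set.

Similar profiles show that at most two agents own objects initially (`not_three_initial_owners`)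
and that, if there are two, then each of them owns everything once the other has left with an
object of her own (`owner_after_pole`). So the two form a dictating set; if there is only one
initial owner, the next dictator is the second pole. Adding dictators one by one gives the
ordering (`HasPoles.exists_isPolarSerial`). The given ownership structure need not be bi-polar at
submatchings that never arise, so it is replaced by `IsPolarSerial.toBipolar`, which leads to the
same matchings.
-/

/-! ### Submatchings of a complete matching, and exchanges -/

namespace Assignment

variable {N O : Type*}

open Classical in
/-- The submatching that a complete matching `μ` induces on the set `S` of agents. Every submatching
the algorithm passes through on its way to `μ` has this form. -/
noncomputable def part (μ : N ≃ O) (S : Set N) : Submatching N O :=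
  (PEquiv.ofSet S).trans μ.toPEquiv

theorem part_eq_some {μ : N ≃ O} {S : Set N} {a : N} {x : O} :
    part μ S a = some x ↔ a ∈ S ∧ μ a = x := by
  classical
  change x ∈ part μ S a ↔ _
  simp only [part, PEquiv.mem_trans, PEquiv.mem_ofSet_iff, Equiv.toPEquiv_apply]
  constructor
  · rintro ⟨b, ⟨rfl, hb⟩, h⟩
    exact ⟨hb, by simpa [eq_comm] using h⟩
  · rintro ⟨ha, rfl⟩
    exact ⟨a, ⟨rfl, ha⟩, by simp⟩

theorem part_congr {μ ν : N ≃ O} {S : Set N} (h : ∀ a ∈ S, μ a = ν a) : part μ S = part ν S := by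
  refine PEquiv.ext fun a => Option.ext fun x => ?_
  rw [part_eq_some, part_eq_some]
  constructor <;> rintro ⟨ha, rfl⟩ <;> exact ⟨ha, by simp [h a ha]⟩

theorem part_eq_iff {μ ν : N ≃ O} {S : Set N} :
    part μ S = part ν S ↔ ∀ a ∈ S, μ a = ν a := by
  refine ⟨fun h a ha => ?_, part_congr⟩
  have : part ν S a = some (μ a) := h ▸ part_eq_some.2 ⟨ha, rfl⟩
  exact (part_eq_some.1 this).2.symm

theorem part_empty (μ : N ≃ O) : part μ ∅ = ⊥ :=
  PEquiv.ext fun a => Option.ext fun x => by simp [part_eq_some]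

theorem part_univ (μ : N ≃ O) : part μ Set.univ = μ.toPEquiv :=
  PEquiv.ext fun a => Option.ext fun x => by simp [part_eq_some, Equiv.toPEquiv_apply]

theorem part_mono (μ : N ≃ O) {S T : Set N} (h : S ⊆ T) : part μ S ≤ part μ T := by
  intro a x hx
  rw [Option.mem_def, part_eq_some] at hx ⊢
  exact ⟨h hx.1, hx.2⟩

@[simp] theorem freeAgent_part {μ : N ≃ O} {S : Set N} {a : N} :
    (part μ S).FreeAgent a ↔ a ∉ S := by
  rw [Submatching.FreeAgent, Option.eq_none_iff_forall_ne_some]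
  simp [part_eq_some]

@[simp] theorem freeObject_part {μ : N ≃ O} {S : Set N} {x : O} :
    (part μ S).FreeObject x ↔ μ.symm x ∉ S := by
  rw [Submatching.FreeObject, Option.eq_none_iff_forall_not_mem]
  constructor
  · intro h hx
    exact h (μ.symm x) ((part μ S).mem_iff_mem.2 (part_eq_some.2 ⟨hx, by simp⟩))
  · intro h a ha
    obtain ⟨ha', rfl⟩ := part_eq_some.1 ((part μ S).mem_iff_mem.1 ha)
    exact h (by simpa using ha')

theorem pointsTo_part {R : Profile N O} {μ : N ≃ O} {S : Set N} {a : N} {x : O} :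
    PointsTo R (part μ S) a x ↔ a ∉ S ∧ μ.symm x ∉ S ∧ ∀ b ∉ S, (R a).le (μ b) x := by
  simp only [PointsTo, freeAgent_part, freeObject_part]
  refine and_congr_right fun _ => and_congr_right fun _ => ⟨fun h b hb => h _ (by simpa), ?_⟩
  intro h y hy
  simpa using h _ hy

theorem PointsTo.unique {R : Profile N O} {σ : Submatching N O} {a : N} {x y : O}
    (hx : PointsTo R σ a x) (hy : PointsTo R σ a y) : x = y :=
  (R a).le_antisymm _ _ (hy.2.2 _ hx.2.1) (hx.2.2 _ hy.2.1)

theorem apply_ne_of_apply_eq {μ : N ≃ O} {a b : N} {x : O} (h : μ a = x) (hab : a ≠ b) :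
    μ b ≠ x :=
  fun hb => hab (μ.injective (h.trans hb.symm))

theorem exists_best [Finite O] (r : LinearOrder O) (s : Set O) (hs : s.Nonempty) :
    ∃ w ∈ s, ∀ y ∈ s, r.le y w := by
  let := r
  obtain ⟨w, hw, h⟩ := Set.exists_max_image s id s.toFinite hs
  exact ⟨w, hw, h⟩

theorem exists_pointsTo [Finite O] (R : Profile N O) {μ : N ≃ O} {S : Set N} {a : N} (ha : a ∉ S) :
    ∃ x, PointsTo R (part μ S) a x := by
  obtain ⟨x, hx, h⟩ := exists_best (R a) {x | μ.symm x ∉ S} ⟨μ a, by simpa⟩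
  exact ⟨x, pointsTo_part.2 ⟨ha, hx, fun b hb => h _ (by simpa)⟩⟩

namespace OwnershipStructure

variable (c : OwnershipStructure N O) (R : Profile N O)

/-- At the submatching that `μ` induces on `S`, the agents in `C` point to the objects given by `p`,
and the owners of these objects are again the agents in `C`: the set `C` is a union of trading
cycles. -/
structure IsExchange (μ : N ≃ O) (S C : Set N) (p : N → O) : Prop where
  pointsTo : ∀ a ∈ C, PointsTo R (part μ S) a (p a)
  bijOn : Set.BijOn (fun a => c.owner (part μ S) (p a)) C C

/-- Starting from the submatching that `μ` induces on `S`, some sequence of exchanges ends with the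
complete matching `μ`. -/
inductive Completes (μ : N ≃ O) : Set N → Prop
  | univ : Completes μ Set.univ
  | exchange {S C : Set N} : c.IsExchange R μ S C μ → Completes μ (S ∪ C) → Completes μ S

/-- Starting from the empty submatching, some sequence of exchanges leads to the submatching that
`μ` induces on `S`. -/
inductive Reaches (μ : N ≃ O) : Set N → Prop
  | empty : Reaches μ ∅
  | exchange {S C : Set N} : Reaches μ S → c.IsExchange R μ S C μ → Reaches μ (S ∪ C)

variable {c R} {μ ν : N ≃ O} {S C D : Set N} {p q : N → O}

theorem IsExchange.congr (h : c.IsExchange R μ S C p) (hμ : ∀ a ∈ S, μ a = ν a)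
    (hp : ∀ a ∈ C, p a = q a) : c.IsExchange R ν S C q := by
  obtain ⟨h1, h2⟩ := h
  rw [part_congr hμ] at h1 h2
  exact ⟨fun a ha => hp a ha ▸ h1 a ha, h2.congr fun a ha => by simp only [hp a ha]⟩

theorem IsExchange.notMem (h : c.IsExchange R μ S C p) {a : N} (ha : a ∈ C) : a ∉ S :=
  freeAgent_part.1 (h.pointsTo a ha).1

theorem IsExchange.eq_of_mem (hC : c.IsExchange R μ S C p) (hD : c.IsExchange R μ S D q)
    {a : N} (haC : a ∈ C) (haD : a ∈ D) : p a = q a :=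
  (hC.pointsTo a haC).unique (hD.pointsTo a haD)

/-- Ownership persists, so after an exchange among `D` the other trading cycles are still there. -/
theorem IsExchange.diff [Finite N] (hC : c.IsExchange R μ S C p) (hD : c.IsExchange R μ S D μ) :
    c.IsExchange R μ (S ∪ D) (C \ D) p := by
  set f : N → N := fun a => c.owner (part μ S) (p a) with hf
  have hmap : Set.MapsTo f (C ∩ D) (C ∩ D) := by
    intro a ha
    refine ⟨hC.bijOn.mapsTo ha.1, ?_⟩
    have := hD.bijOn.mapsTo ha.2
    simpa only [hf, hC.eq_of_mem hD ha.1 ha.2] using this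
  have hsurj : Set.SurjOn f (C ∩ D) (C ∩ D) :=
    ((Set.toFinite _).injOn_iff_bijOn_of_mapsTo hmap).1
      (hC.bijOn.injOn.mono Set.inter_subset_left) |>.surjOn
  have hout : ∀ a ∈ C \ D, f a ∈ C \ D := by
    rintro a ⟨haC, haD⟩
    refine ⟨hC.bijOn.mapsTo haC, fun h => haD ?_⟩
    obtain ⟨b, hb, hba⟩ := hsurj ⟨hC.bijOn.mapsTo haC, h⟩
    rw [← hC.bijOn.injOn hb.1 haC hba]
    exact hb.2
  -- An object sought by `C \ D` is not handed out in `D`, because it has a different owner.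
  have hfree : ∀ a ∈ C \ D, μ.symm (p a) ∉ S ∪ D := by
    rintro a ha (h | h)
    · exact (pointsTo_part.1 (hC.pointsTo a ha.1)).2.1 h
    · have := hD.bijOn.mapsTo h
      simp only [Equiv.apply_symm_apply] at this
      exact (hout a ha).2 this
  have hown : ∀ a ∈ C \ D, c.owner (part μ (S ∪ D)) (p a) = f a := by
    intro a ha
    refine c.persistent _ _ _ _ (part_mono μ Set.subset_union_left) ?_ ?_ rfl
    · exact freeObject_part.2 (hfree a ha)
    · have := c.owner_free _ _ (hC.pointsTo a ha.1).2.1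
      rw [freeAgent_part] at this ⊢
      rintro (h | h)
      · exact this h
      · exact (hout a ha).2 h
  refine ⟨fun a ha => ?_, ?_⟩
  · have h := pointsTo_part.1 (hC.pointsTo a ha.1)
    refine pointsTo_part.2 ⟨?_, hfree a ha, fun b hb => h.2.2 b fun hb' => hb (Or.inl hb')⟩
    rintro (h' | h')
    · exact h.1 h'
    · exact ha.2 h'
  · refine Set.BijOn.congr (f₁ := f) ⟨hout, hC.bijOn.injOn.mono Set.sdiff_subset, ?_⟩
      fun a ha => (hown a ha).symm
    rintro b ⟨hbC, hbD⟩
    obtain ⟨a, ha, rfl⟩ := hC.bijOn.surjOn hbC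
    exact ⟨a, ⟨ha, fun h => hbD (hmap ⟨ha, h⟩).2⟩, rfl⟩

/-- The order of exchanges is immaterial: each exchange that is possible on the way to `μ` agrees
with `μ`, and `μ` is still reached after it. -/
theorem Completes.after_exchange [Finite N] (h : c.Completes R μ S) :
    ∀ {C : Set N} {p : N → O}, c.IsExchange R μ S C p →
      (∀ a ∈ C, p a = μ a) ∧ c.Completes R μ (S ∪ C) := by
  induction h with
  | univ =>
    intro C p hC
    exact ⟨fun a ha => (hC.notMem ha trivial).elim, by simpa using Completes.univ⟩
  | @exchange S D hD h ih =>
    intro C p hC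
    obtain ⟨h1, h2⟩ := ih (hC.diff hD)
    have hp : ∀ a ∈ C, p a = μ a := fun a ha => by
      by_cases haD : a ∈ D
      · exact hC.eq_of_mem hD ha haD
      · exact h1 a ⟨ha, haD⟩
    refine ⟨hp, .exchange (hD.diff (hC.congr (fun _ _ => rfl) hp)) ?_⟩
    have : S ∪ C ∪ D \ C = S ∪ D ∪ C \ D := by
      ext; simp; tauto
    rwa [this]

theorem Reaches.agrees [Finite N] (hν : c.Reaches R ν S) (hμ : c.Completes R μ ∅) :
    (∀ a ∈ S, ν a = μ a) ∧ c.Completes R μ S := by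
  induction hν with
  | empty => exact ⟨fun a ha => ha.elim, hμ⟩
  | exchange _ hC ih =>
    obtain ⟨h1, h2⟩ := ih
    obtain ⟨h3, h4⟩ := h2.after_exchange (hC.congr h1 fun _ _ => rfl)
    exact ⟨fun a ha => ha.elim (h1 a) (h3 a), h4⟩

theorem Reaches.completes (h : c.Reaches R μ S) (h' : c.Completes R μ S) :
    c.Completes R μ ∅ := by
  induction h with
  | empty => exact h'
  | exchange _ hC ih => exact ih (.exchange hC h')

end OwnershipStructure
end Assignment

/-! ### The algorithm and sequences of exchanges -/

namespace Assignment

variable {N O : Type*}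

namespace OwnershipStructure

variable {c : OwnershipStructure N O} {R : Profile N O} {μ ν : N ≃ O} {S C D : Set N} {p q : N → O}

theorem PointsToOwner.owner_eq {σ : Submatching N O} {a b : N} {x : O}
    (h : c.PointsToOwner R σ a b) (hx : PointsTo R σ a x) : c.owner σ x = b := by
  obtain ⟨y, hy, rfl⟩ := h
  rw [hx.unique hy]

theorem InTradingCycle.exists_pointsTo {σ : Submatching N O} {a : N}
    (h : c.InTradingCycle R σ a) : ∃ x, PointsTo R σ a x := by
  obtain ⟨b, ⟨x, hx, -⟩, -⟩ := Relation.TransGen.head'_iff.1 h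
  exact ⟨x, hx⟩

/-- The agents on trading cycles form an exchange: on this finite set, the map from an agent to the
owner of the object she points to is onto, hence bijective. -/
theorem isExchange_inTradingCycle [Finite N]
    (hp : ∀ a, c.InTradingCycle R (part μ S) a → PointsTo R (part μ S) a (p a)) :
    c.IsExchange R μ S {a | c.InTradingCycle R (part μ S) a} p := by
  refine ⟨hp, ?_⟩
  have hmaps : Set.MapsTo (fun a => c.owner (part μ S) (p a))
      {a | c.InTradingCycle R (part μ S) a} {a | c.InTradingCycle R (part μ S) a} := by
    intro a ha
    obtain ⟨b, hab, hba⟩ := Relation.TransGen.head'_iff.1 (show Relation.TransGen _ a a from ha)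
    have := hab.owner_eq (hp a ha)
    simp only [Set.mem_ofPred_eq, this]
    exact Relation.TransGen.tail'_iff.2 ⟨a, hba, hab⟩
  refine ((Set.toFinite _).surjOn_iff_bijOn_of_mapsTo hmaps).1 ?_
  intro b hb
  obtain ⟨a, hba, hab⟩ := Relation.TransGen.tail'_iff.1 (show Relation.TransGen _ b b from hb)
  have ha : c.InTradingCycle R (part μ S) a := Relation.TransGen.head'_iff.2 ⟨b, hab, hba⟩
  exact ⟨a, ha, hab.owner_eq (hp a ha)⟩

/-- Only agents on trading cycles take part in an exchange. -/
theorem IsExchange.inTradingCycle [Finite N] (h : c.IsExchange R μ S C p) {a : N} (ha : a ∈ C) :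
    c.InTradingCycle R (part μ S) a := by
  set f : N → N := fun a => c.owner (part μ S) (p a) with hf
  have hstep : ∀ b ∈ C, c.PointsToOwner R (part μ S) b (f b) :=
    fun b hb => ⟨p b, h.pointsTo b hb, rfl⟩
  -- The agents whom `a` leads to form a set that `f` maps injectively, hence onto, itself.
  set B : Set N := {b | b ∈ C ∧ Relation.ReflTransGen (c.PointsToOwner R (part μ S)) a b}
  have hmaps : Set.MapsTo f B B := fun b hb => ⟨h.bijOn.mapsTo hb.1, hb.2.tail (hstep b hb.1)⟩
  have hsurj := (((Set.toFinite B).injOn_iff_bijOn_of_mapsTo hmaps).1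
    (h.bijOn.injOn.mono fun b hb => hb.1)).surjOn
  obtain ⟨b, hb, hba⟩ := hsurj ⟨ha, .refl⟩
  exact Relation.TransGen.tail'_iff.2 ⟨b, hb.2, hba ▸ hstep b hb.1⟩

theorem Round.le {σ σ' : Submatching N O} (h : c.Round R σ σ') : σ ≤ σ' :=
  fun a x hx => (h a x).2 (Or.inl hx)

theorem eq_part_of_le {σ : Submatching N O} (h : σ ≤ μ.toPEquiv) :
    σ = part μ {a | ∃ x, σ a = some x} := by
  refine PEquiv.ext fun a => Option.ext fun x => ?_
  rw [part_eq_some]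
  have hle : ∀ y, σ a = some y → μ a = y := fun y hy => by
    have := h a y hy
    simpa [Equiv.toPEquiv_apply] using this
  constructor
  · exact fun hx => ⟨⟨x, hx⟩, hle x hx⟩
  · rintro ⟨⟨y, hy⟩, rfl⟩
    rw [hle y hy, hy]

theorem Completes.of_rounds [Finite N] {σ : Submatching N O}
    (h : Relation.ReflTransGen (c.Round R) σ μ.toPEquiv) :
    σ ≤ μ.toPEquiv ∧ c.Completes R μ {a | ∃ x, σ a = some x} := by
  induction h using Relation.ReflTransGen.head_induction_on with
  | refl =>
    refine ⟨le_rfl, ?_⟩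
    have : {a | ∃ x, μ.toPEquiv a = some x} = Set.univ := by
      ext a; simp [Equiv.toPEquiv_apply]
    rw [this]
    exact .univ
  | @head σ τ hστ _ ih =>
    obtain ⟨hτ, ih⟩ := ih
    have hσ := hστ.le.trans hτ
    refine ⟨hσ, ?_⟩
    have hpart := eq_part_of_le hσ
    set S : Set N := {a | ∃ x, σ a = some x} with hS
    have hp : ∀ a x, c.InTradingCycle R σ a → PointsTo R σ a x → μ a = x := by
      intro a x ha hx
      have := hτ a x ((hστ a x).2 (Or.inr ⟨ha, hx⟩))
      simpa [Equiv.toPEquiv_apply] using this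
    refine .exchange (C := {a | c.InTradingCycle R σ a}) ?_ ?_
    · rw [hpart]
      refine isExchange_inTradingCycle ?_
      rw [← hpart]
      intro a ha
      obtain ⟨x, hx⟩ := ha.exists_pointsTo
      rwa [hp a x ha hx]
    · convert ih using 1
      ext a
      simp only [hS, Set.mem_union, Set.mem_ofPred_eq]
      constructor
      · rintro (⟨x, hx⟩ | ha)
        · exact ⟨x, (hστ a x).2 (Or.inl hx)⟩
        · obtain ⟨x, hx⟩ := ha.exists_pointsTo
          exact ⟨x, (hστ a x).2 (Or.inr ⟨ha, hx⟩)⟩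
      · rintro ⟨x, hx⟩
        rcases (hστ a x).1 hx with h | h
        · exact Or.inl ⟨x, h⟩
        · exact Or.inr h.1

/-- Exchanges may be empty; before `μ` is reached there is one that is not. -/
theorem Completes.exists_exchange (h : c.Completes R μ S) (hS : S ≠ Set.univ) :
    ∃ C, C.Nonempty ∧ c.IsExchange R μ S C μ := by
  induction h with
  | univ => exact (hS rfl).elim
  | @exchange S C hC _ ih =>
    rcases C.eq_empty_or_nonempty with rfl | hne
    · rw [Set.union_empty] at ih
      exact ih hS
    · exact ⟨C, hne, hC⟩

/-- Any sequence of exchanges that ends with `μ` can be rearranged into rounds, in which all trading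
cycles are carried out at once. -/
theorem Completes.rounds [Finite N] (h : c.Completes R μ S) :
    Relation.ReflTransGen (c.Round R) (part μ S) μ.toPEquiv := by
  induction hn : Sᶜ.ncard using Nat.strong_induction_on generalizing S with
  | _ n ih =>
    by_cases hS : S = Set.univ
    · rw [hS, part_univ]
    obtain ⟨D, ⟨d, hd⟩, hD⟩ := h.exists_exchange hS
    have hdcycle := hD.inTradingCycle hd
    set C : Set N := {a | c.InTradingCycle R (part μ S) a} with hCdef
    have hex : ∀ a, ∃ x, c.InTradingCycle R (part μ S) a → PointsTo R (part μ S) a x := by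
      intro a
      by_cases ha : c.InTradingCycle R (part μ S) a
      · exact ha.exists_pointsTo.imp fun x hx _ => hx
      · exact ⟨μ a, fun h => (ha h).elim⟩
    choose p hp using hex
    have hC : c.IsExchange R μ S C p := isExchange_inTradingCycle hp
    obtain ⟨hpμ, hnext⟩ := h.after_exchange hC
    -- The agents on cycles, `d` among them, leave in one round.
    refine .head (b := part μ (S ∪ C)) ?_ (ih _ ?_ hnext rfl)
    · intro a x
      simp only [Option.mem_def, part_eq_some, Set.mem_union]
      constructor
      · rintro ⟨ha | ha, rfl⟩
        · exact Or.inl ⟨ha, rfl⟩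
        · exact Or.inr ⟨ha, hpμ a ha ▸ hp a ha⟩
      · rintro (⟨ha, rfl⟩ | ⟨ha, hx⟩)
        · exact ⟨Or.inl ha, rfl⟩
        · exact ⟨Or.inr ha, (hpμ a ha).symm.trans ((hp a ha).unique hx)⟩
    · rw [← hn]
      refine Set.ncard_lt_ncard ⟨Set.compl_subset_compl.2 Set.subset_union_left, fun hsub => ?_⟩
        (Set.toFinite _)
      exact hsub (hD.notMem hd) (Or.inr hdcycle)

/-- The matching selected by the algorithm, which carries out all trading cycles in each round, can
be found with any sequence of exchanges. -/
theorem implements_iff [Finite N] {φ : Rule N O} :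
    c.Implements φ ↔ ∀ R, c.Completes R (φ R) ∅ := by
  refine forall_congr' fun R => ⟨fun h => ?_, fun h => ?_⟩
  · have := (Completes.of_rounds h).2
    simpa using this
  · have := h.rounds
    rwa [part_empty] at this

/-- Pareto efficiency. -/
theorem Completes.eq_of_forall_le (h : c.Completes R μ S) (hS : ∀ a ∈ S, ν a = μ a)
    (hν : ∀ a, (R a).le (μ a) (ν a)) : ν = μ := by
  induction h with
  | univ => exact Equiv.ext fun a => hS a trivial
  | @exchange S C hC _ ih =>
    refine ih ?_
    rintro a (ha | ha)
    · exact hS a ha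
    · obtain ⟨h1, -, h2⟩ := pointsTo_part.1 (hC.pointsTo a ha)
      refine (R a).le_antisymm _ _ ?_ (hν a)
      have := h2 (μ.symm (ν a)) fun hb => h1 ?_
      · simpa using this
      · have := hS _ hb
        rw [Equiv.apply_symm_apply] at this
        rwa [ν.injective this] at hb

/-- What remains to be done at a submatching depends only on how the unmatched agents rank the
unassigned objects. -/
theorem Completes.congr_profile {R' : Profile N O} (h : c.Completes R μ S)
    (hR : ∀ a ∉ S, ∀ b ∉ S, ∀ d ∉ S, (R a).le (μ b) (μ d) → (R' a).le (μ b) (μ d)) :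
    c.Completes R' μ S := by
  induction h with
  | univ => exact .univ
  | @exchange S C hC _ ih =>
    refine .exchange (C := C) ⟨fun a ha => ?_, hC.bijOn⟩ (ih fun a ha b hb d hd => ?_)
    · obtain ⟨h1, h2, h3⟩ := pointsTo_part.1 (hC.pointsTo a ha)
      exact pointsTo_part.2 ⟨h1, h2, fun b hb => hR a h1 b hb a h1 (h3 b hb)⟩
    · exact hR a (fun h => ha (Or.inl h)) b (fun h => hb (Or.inl h)) d (fun h => hd (Or.inl h))

theorem isExchange_singleton {a : N} {x : O} (ha : PointsTo R (part μ S) a x)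
    (hx : c.owner (part μ S) x = a) : c.IsExchange R μ S {a} fun _ => x :=
  ⟨by rintro _ rfl; exact ha, by simp [hx]⟩

theorem isExchange_pair {a b : N} (hab : a ≠ b) (ha : PointsTo R (part μ S) a (p a))
    (hb : PointsTo R (part μ S) b (p b)) (hpa : c.owner (part μ S) (p a) = b)
    (hpb : c.owner (part μ S) (p b) = a) : c.IsExchange R μ S {a, b} p := by
  refine ⟨by rintro _ (rfl | rfl) <;> assumption, ?_, ?_, ?_⟩
  · rintro _ (rfl | rfl) <;> simp [hpa, hpb]
  · rintro _ (rfl | rfl) _ (rfl | rfl) <;> simp [hpa, hpb, hab, hab.symm]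
  · rintro _ (rfl | rfl)
    · exact ⟨b, by simp, hpb⟩
    · exact ⟨a, by simp, hpa⟩

/-- An agent who owns the best unassigned object gets it. -/
theorem Completes.apply_eq_of_owner [Finite N] (h : c.Completes R μ S) {a : N} {x : O}
    (ha : PointsTo R (part μ S) a x) (hx : c.owner (part μ S) x = a) :
    μ a = x ∧ c.Completes R μ (insert a S) := by
  obtain ⟨h1, h2⟩ := h.after_exchange (isExchange_singleton ha hx)
  exact ⟨(h1 a rfl).symm, by rwa [Set.union_singleton] at h2⟩

/-- Two agents who own each other's best unassigned object swap. -/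
theorem Completes.apply_eq_of_swap [Finite N] (h : c.Completes R μ S) {a b : N} (hab : a ≠ b)
    {x y : O} (ha : PointsTo R (part μ S) a x) (hb : PointsTo R (part μ S) b y)
    (hx : c.owner (part μ S) x = b) (hy : c.owner (part μ S) y = a) : μ a = x ∧ μ b = y := by
  classical
  obtain ⟨h1, -⟩ := h.after_exchange (C := {a, b}) (p := fun d => if d = a then x else y)
    (isExchange_pair hab (by simpa) (by simpa [hab.symm]) (by simpa) (by simpa [hab.symm]))
  have h2 := h1 a (by simp)
  have h3 := h1 b (by simp)
  simp only [if_true, hab.symm, if_false] at h2 h3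
  exact ⟨h2.symm, h3.symm⟩

theorem Completes.apply_eq_of_owner_bot [Finite N] {i : N} {x : O} (h : c.Completes R μ ∅)
    (hi : ∀ o, (R i).le o x)
    (hx : c.owner ⊥ x = i) : μ i = x ∧ c.Completes R μ {i} := by
  rw [← part_empty μ] at hx
  have := h.apply_eq_of_owner (pointsTo_part.2 ⟨by simp, by simp, fun _ _ => hi _⟩) hx
  rwa [insert_empty_eq] at this

theorem Completes.apply_eq_of_swap_bot [Finite N] {i j : N} {x y : O} (h : c.Completes R μ ∅)
    (hij : i ≠ j) (hi : ∀ o, (R i).le o x) (hj : ∀ o, (R j).le o y)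
    (hx : c.owner ⊥ x = j) (hy : c.owner ⊥ y = i) : μ i = x ∧ μ j = y := by
  rw [← part_empty μ] at hx hy
  exact h.apply_eq_of_swap hij (pointsTo_part.2 ⟨by simp, by simp, fun _ _ => hi _⟩)
    (pointsTo_part.2 ⟨by simp, by simp, fun _ _ => hj _⟩) hx hy

/-- The owner of all unassigned objects gets the best of them. -/
theorem Completes.le_apply_of_owner [Finite N] (h : c.Completes R μ S) {d : N} (hd : d ∉ S)
    (hown : ∀ b ∉ S, c.owner (part μ S) (μ b) = d) : ∀ b ∉ S, (R d).le (μ b) (μ d) := by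
  have : Finite O := Finite.of_equiv N μ
  obtain ⟨x, hx⟩ := exists_pointsTo R (μ := μ) hd
  obtain ⟨-, h1, h2⟩ := pointsTo_part.1 hx
  have := hown _ h1
  rw [Equiv.apply_symm_apply] at this
  rw [(h.apply_eq_of_owner hx this).1]
  exact h2

theorem Completes.apply_eq_of_part_eq [Finite N] {a : N} {x : O}
    (h : c.Completes R μ S) (hμν : part μ S = part ν S) (ha : a ∉ S)
    (hx : ν.symm x ∉ S) (hbest : ∀ o, (R a).le o x) (hown : c.owner (part ν S) x = a) :
    μ a = x := by
  refine (h.apply_eq_of_owner ?_ (hμν ▸ hown)).1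
  rw [hμν]
  exact pointsTo_part.2 ⟨ha, hx, fun b _ => hbest _⟩

theorem Completes.unique [Finite N]
    (hν : c.Completes R ν S) (hμ : c.Completes R μ S) (h : ∀ a ∈ S, ν a = μ a) : ν = μ := by
  induction hν with
  | univ => exact Equiv.ext fun a => h a trivial
  | @exchange S C hC _ ih =>
    obtain ⟨h1, h2⟩ := hμ.after_exchange (hC.congr h fun _ _ => rfl)
    exact ih h2 fun a ha => ha.elim (h a) (h1 a)

theorem Reaches.insert_of_owner (h : c.Reaches R μ S) {a : N} (haS : a ∉ S)
    (ha : ∀ b ∉ S, (R a).le (μ b) (μ a)) (hx : c.owner (part μ S) (μ a) = a) :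
    c.Reaches R μ (insert a S) := by
  rw [← Set.union_singleton]
  refine h.exchange ((isExchange_singleton (x := μ a) (pointsTo_part.2 ⟨haS, by simpa, ha⟩)
    hx).congr (fun _ _ => rfl) ?_)
  rintro _ rfl
  rfl

theorem reaches_pair_of_swap {a b : N} (hab : a ≠ b) (ha : ∀ d, (R a).le (μ d) (μ a))
    (hb : ∀ d, (R b).le (μ d) (μ b)) (hx : c.owner ⊥ (μ a) = b) (hy : c.owner ⊥ (μ b) = a) :
    c.Reaches R μ {a, b} := by
  rw [← part_empty μ] at hx hy
  rw [← Set.empty_union {a, b}]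
  exact Reaches.empty.exchange (isExchange_pair hab
    (pointsTo_part.2 ⟨by simp, by simp, fun d _ => ha d⟩)
    (pointsTo_part.2 ⟨by simp, by simp, fun d _ => hb d⟩) hx hy)

end OwnershipStructure
end Assignment

/-! ### Bi-polar ownership, serial dictatorship and the bound on menus -/

namespace Assignment

variable {N O : Type*}

/-- The first `m` agents in the ordering `e`. -/
def initial {n : ℕ} (e : Fin n ≃ N) (m : ℕ) : Set N := {a | (e.symm a).val < m}

theorem mem_initial {n : ℕ} {e : Fin n ≃ N} {m : ℕ} {a : N} :
    a ∈ initial e m ↔ (e.symm a).val < m := Iff.rfl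

theorem initial_succ {n : ℕ} (e : Fin n ≃ N) (m : Fin n) :
    initial e (m.val + 1) = insert (e m) (initial e m.val) := by
  ext a
  rw [Set.mem_insert_iff, mem_initial, mem_initial, Nat.lt_succ_iff_lt_or_eq, or_comm,
    ← Fin.ext_iff, Equiv.symm_apply_eq]

theorem initial_two {n : ℕ} {e : Fin n ≃ N} {i j : N} (hi : (e.symm i).val = 0)
    (hj : (e.symm j).val = 1) : initial e 2 = {i, j} := by
  ext a
  have h1 : a = i ↔ (e.symm a).val = 0 := by
    rw [← hi, ← Fin.ext_iff, e.symm.injective.eq_iff]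
  have h2 : a = j ↔ (e.symm a).val = 1 := by
    rw [← hj, ← Fin.ext_iff, e.symm.injective.eq_iff]
  rw [Set.mem_insert_iff, Set.mem_singleton_iff, mem_initial, h1, h2]
  omega

theorem initial_eq_univ {n : ℕ} (e : Fin n ≃ N) : initial e n = Set.univ :=
  Set.eq_univ_of_forall fun a => (e.symm a).isLt

namespace OwnershipStructure

variable {c c' : OwnershipStructure N O} {R : Profile N O} {μ ν : N ≃ O} {i j : N}

/-- Initially every object belongs to `i` or to `j`. As soon as one of these agents has left with an
object of her own, everything belongs to the other. -/
structure HasPoles (c : OwnershipStructure N O) (i j : N) : Prop where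
  ne : i ≠ j
  owner_bot : ∀ x, c.owner ⊥ x = i ∨ c.owner ⊥ x = j
  left : ∀ μ : N ≃ O, c.owner ⊥ (μ i) = i → ∀ b ≠ i, c.owner (part μ {i}) (μ b) = j
  right : ∀ μ : N ≃ O, c.owner ⊥ (μ j) = j → ∀ b ≠ j, c.owner (part μ {j}) (μ b) = i

theorem HasPoles.symm (h : c.HasPoles i j) : c.HasPoles j i :=
  ⟨h.ne.symm, fun x => (h.owner_bot x).symm, h.right, h.left⟩

/-- At `μ`, each of `i` and `j` gets the best object not taken by the other, and if one of them does
not get her best object, then the other has got her own. Here `r` and `s` are the preferences of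
`i` and `j`, and `own` gives the initial owners. -/
def PoleOutcome (own : O → N) (r s : LinearOrder O) (μ : N ≃ O) (i j : N) : Prop :=
  ((∀ b, r.le (μ b) (μ i)) ∧ ∀ b, s.le (μ b) (μ j)) ∨
  ((∀ b, r.le (μ b) (μ i)) ∧ own (μ i) = i ∧ ∀ b ≠ i, s.le (μ b) (μ j)) ∨
  ((∀ b, s.le (μ b) (μ j)) ∧ own (μ j) = j ∧ ∀ b ≠ j, r.le (μ b) (μ i))

theorem PoleOutcome.symm {own : O → N} {r s : LinearOrder O} (h : PoleOutcome own r s μ i j) :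
    PoleOutcome own s r μ j i := by
  rcases h with h | h | h
  exacts [Or.inl h.symm, Or.inr (Or.inr h), Or.inr (Or.inl h)]

theorem PoleOutcome.le_apply_right {own : O → N} {r s : LinearOrder O}
    (h : PoleOutcome own r s μ i j) : ∀ b ≠ i, s.le (μ b) (μ j) := by
  rcases h with h | h | h
  exacts [fun b _ => h.2 b, h.2.2, fun b _ => h.1 b]

/-- The case in which `i` owns her best object. -/
theorem HasPoles.poleOutcome_of_owner [Finite N] (hc : c.HasPoles i j) (h : c.Completes R μ ∅)
    {x : O} (hx : PointsTo R (part μ ∅) i x) (hown : c.owner ⊥ x = i) :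
    PoleOutcome (c.owner ⊥) (R i) (R j) μ i j := by
  rw [← part_empty μ] at hown
  obtain ⟨rfl, h'⟩ := h.apply_eq_of_owner hx hown
  rw [part_empty μ] at hown
  rw [insert_empty_eq] at h'
  exact Or.inr (Or.inl ⟨fun b => (pointsTo_part.1 hx).2.2 b (by simp), hown,
    h'.le_apply_of_owner (by simpa using hc.ne.symm) (hc.left μ hown)⟩)

theorem HasPoles.poleOutcome [Finite N] (hc : c.HasPoles i j) (h : c.Completes R μ ∅) :
    PoleOutcome (c.owner ⊥) (R i) (R j) μ i j := by
  have : Finite O := Finite.of_equiv N μ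
  obtain ⟨x, hx⟩ := exists_pointsTo R (μ := μ) (Set.notMem_empty i)
  obtain ⟨y, hy⟩ := exists_pointsTo R (μ := μ) (Set.notMem_empty j)
  rcases hc.owner_bot x with hxi | hxj
  · exact hc.poleOutcome_of_owner h hx hxi
  rcases hc.owner_bot y with hyi | hyj
  · rw [← part_empty μ] at hxj hyi
    obtain ⟨rfl, rfl⟩ := h.apply_eq_of_swap hc.ne hx hy hxj hyi
    exact Or.inl ⟨fun b => (pointsTo_part.1 hx).2.2 b (by simp),
      fun b => (pointsTo_part.1 hy).2.2 b (by simp)⟩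
  · exact (hc.symm.poleOutcome_of_owner h hy hyj).symm

theorem HasPoles.reaches_of_owner (hc : c.HasPoles i j) (hi : ∀ b, (R i).le (μ b) (μ i))
    (hj : ∀ b ≠ i, (R j).le (μ b) (μ j)) (hown : c.owner ⊥ (μ i) = i) : c.Reaches R μ {i, j} := by
  have h1 : c.Reaches R μ (insert i ∅) := Reaches.empty.insert_of_owner (by simp) (fun b _ => hi b)
    (by rwa [part_empty])
  rw [insert_empty_eq] at h1
  have h2 := h1.insert_of_owner (a := j) (by simpa using hc.ne.symm) (fun b hb => hj b hb)
    (hc.left μ hown j hc.ne.symm)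
  rwa [Set.pair_comm]

theorem HasPoles.reaches (hc : c.HasPoles i j)
    (h : PoleOutcome (c.owner ⊥) (R i) (R j) μ i j) : c.Reaches R μ {i, j} := by
  rcases h with ⟨hi, hj⟩ | ⟨hi, hown, hj⟩ | ⟨hj, hown, hi⟩
  · rcases hc.owner_bot (μ i) with h1 | h1
    · exact hc.reaches_of_owner hi (fun b _ => hj b) h1
    rcases hc.owner_bot (μ j) with h2 | h2
    · exact reaches_pair_of_swap hc.ne hi hj h1 h2
    · rw [Set.pair_comm]
      exact hc.symm.reaches_of_owner hj (fun b _ => hi b) h2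
  · exact hc.reaches_of_owner hi hj hown
  · rw [Set.pair_comm]
    exact hc.symm.reaches_of_owner hj hi hown

/-- The agents in `S` dictate: if their best objects are different, they get them. -/
def Dictates (c : OwnershipStructure N O) (S : Set N) : Prop :=
  ∀ (R : Profile N O) (μ : N ≃ O), (∀ a ∈ S, ∀ o, (R a).le o (μ a)) → c.Reaches R μ S

theorem Dictates.insert {S : Set N} (hS : Dictates c S) {d : N} (hd : d ∉ S)
    (hown : ∀ μ : N ≃ O, ∀ b ∉ S, c.owner (part μ S) (μ b) = d) : Dictates c (insert d S) :=
  fun R μ h => (hS R μ fun a ha => h a (Or.inr ha)).insert_of_owner hd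
    (fun _ _ => h d (Or.inl rfl) _) (hown μ d hd)

theorem dictates_empty : Dictates c ∅ := fun _ _ _ => .empty

theorem HasPoles.dictates (hc : c.HasPoles i j) : Dictates c {i, j} :=
  fun _ _ h => hc.reaches (Or.inl ⟨fun _ => h i (by simp) _, fun _ => h j (by simp) _⟩)

/-- The poles are the first two agents of the ordering `e`, and when precisely the first `m ≥ 2`
agents have left, all remaining objects belong to the next one. -/
structure IsPolarSerial {n : ℕ} (c : OwnershipStructure N O) (e : Fin n ≃ N) (i j : N) :
    Prop where
  hasPoles : c.HasPoles i j
  left_pos : (e.symm i).val = 0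
  right_pos : (e.symm j).val = 1
  owner_tail : ∀ m : Fin n, 2 ≤ m.val → ∀ (μ : N ≃ O), ∀ b ∉ initial e m,
    c.owner (part μ (initial e m)) (μ b) = e m

/-- Two such ownership structures with the same ordering and the same initial owners lead to the
same matching, and the assignments of the first `m ≥ 2` agents are independent of the preferences
of the others. -/
theorem IsPolarSerial.reaches [Finite N] {n : ℕ} {e : Fin n ≃ N} (hc : c.IsPolarSerial e i j)
    (h : c.Completes R μ ∅) {m : ℕ} (hm : 2 ≤ m) (hmn : m ≤ n) :
    ∀ {c' : OwnershipStructure N O} {R' : Profile N O}, c'.IsPolarSerial e i j →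
      c'.owner ⊥ = c.owner ⊥ → (∀ a ∈ initial e m, R' a = R a) →
      c'.Reaches R' μ (initial e m) := by
  induction m, hm using Nat.le_induction with
  | base =>
    intro c' R' hc' hbot hR
    rw [initial_two hc.left_pos hc.right_pos] at hR ⊢
    refine hc'.hasPoles.reaches ?_
    rw [hR i (by simp), hR j (by simp), hbot]
    exact hc.hasPoles.poleOutcome h
  | succ m hm ih =>
    intro c' R' hc' hbot hR
    have hmem : e ⟨m, hmn⟩ ∉ initial e m := by simp [mem_initial]
    have hstep := initial_succ e ⟨m, hmn⟩
    simp only at hstep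
    rw [hstep] at hR ⊢
    have hle := ((ih (by omega) hc rfl fun _ _ => rfl).agrees h).2.le_apply_of_owner hmem
      (hc.owner_tail ⟨m, hmn⟩ hm μ)
    refine (ih (by omega) hc' hbot fun a ha => hR a (by simp [ha])).insert_of_owner hmem ?_
      (hc'.owner_tail ⟨m, hmn⟩ hm μ _ hmem)
    rwa [hR _ (by simp)]

/-- From the third agent on, each gets the best object not taken by her predecessors. -/
theorem IsPolarSerial.le_apply [Finite N] {n : ℕ} {e : Fin n ≃ N} (hc : c.IsPolarSerial e i j)
    (h : c.Completes R μ ∅) (m : Fin n) (hm : 2 ≤ m.val) :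
    ∀ b ∉ initial e m, (R (e m)).le (μ b) (μ (e m)) :=
  ((hc.reaches h hm m.isLt.le hc rfl fun _ _ => rfl).agrees h).2.le_apply_of_owner
    (by simp [mem_initial]) (hc.owner_tail m hm μ)

/-- With at most one agent every ownership structure is bi-polar. -/
theorem isBipolar_of_le_one {n : ℕ} (c : OwnershipStructure N O) (e : Fin n ≃ N) (hn : n ≤ 1) :
    c.IsBipolar e := by
  refine ⟨fun x => by omega, ?_⟩
  rintro σ ⟨m, -, hm⟩ x - k hk
  have : m = k := Fin.ext (by omega)
  exact (hm (this ▸ hk)).elim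

/-- Bi-polarity refers to all submatchings; only those of the sets `initial e m` are needed. -/
theorem IsBipolar.isPolarSerial {n : ℕ} {e : Fin n ≃ N} (hc : c.IsBipolar e) (hn : 2 ≤ n) :
    c.IsPolarSerial e (e ⟨0, by omega⟩) (e ⟨1, by omega⟩) := by
  obtain ⟨h1, h2⟩ := hc
  have hfirst : ∀ (μ : N ≃ O) (S : Set N) (k m : Fin n), m.val < 2 → e m ∈ S → e k ∉ S →
      (∀ l, e l ∉ S → k ≤ l) → ∀ b ∉ S, c.owner (part μ S) (μ b) = e k := by
    intro μ S k m hm hmS hkS hk b hb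
    refine (h2 (part μ S) ⟨m, hm, by simpa⟩ (μ b) (by simpa) k (by simpa)).1 ?_
    simpa using hk
  refine ⟨⟨by simp, fun x => ?_, fun μ _ => ?_, fun μ _ => ?_⟩, by simp, by simp, ?_⟩
  · have := h1 x
    rw [← Equiv.symm_apply_eq, ← Equiv.symm_apply_eq, Fin.ext_iff, Fin.ext_iff]
    simp only
    omega
  · refine hfirst μ {e ⟨0, by omega⟩} _ ⟨0, by omega⟩ (by simp) (by simp) (by simp) fun l hl => ?_
    simp only [Set.mem_singleton_iff, e.injective.eq_iff, Fin.ext_iff] at hl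
    rw [Fin.le_def]
    simp only
    omega
  · refine hfirst μ {e ⟨1, by omega⟩} _ ⟨1, by omega⟩ (by simp) (by simp) (by simp) fun l hl => ?_
    rw [Fin.le_def]
    simp
  · intro m hm μ
    refine hfirst μ _ m ⟨0, by omega⟩ (by simp) ?_ ?_ fun l hl => ?_
    · simp [mem_initial]; omega
    · simp [mem_initial]
    · simpa [mem_initial] using hl

end OwnershipStructure

/-- If the matchings in a family differ on `S` by one object, then the next agent in line gets one
of two objects, and the matchings still differ by one object after her choice. -/
theorem exists_two_choices [Finite O] {ι : Type*} [Nonempty ι] {μ : ι → N ≃ O} {S : Set N}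
    {A : Set O} {d : N} (hd : d ∉ S) (r : LinearOrder O) (hA : ∀ t, ∃ x, μ t '' S = insert x A)
    (hr : ∀ t, ∀ b ∉ S, r.le (μ t b) (μ t d)) :
    (∃ A', ∀ t, ∃ x, μ t '' insert d S = insert x A') ∧
      ∃ x y, ∀ t, μ t d = x ∨ μ t d = y := by
  obtain ⟨t₀⟩ := ‹Nonempty ι›
  have hle : ∀ t, ∀ y ∉ μ t '' S, r.le y (μ t d) := by
    intro t y hy
    have := hr t ((μ t).symm y) fun h => hy ⟨_, h, by simp⟩
    simpa using this
  have hnot : ∀ t, μ t d ∉ μ t '' S := by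
    rintro t ⟨b, hb, h⟩
    rw [(μ t).injective h] at hb
    exact hd hb
  -- The two objects are the best object outside `A` and the runner-up.
  obtain ⟨x, hx, hxb⟩ := exists_best r Aᶜ ⟨μ t₀ d, fun h => by
    obtain ⟨y, hy⟩ := hA t₀
    exact hnot t₀ (hy ▸ Or.inr h)⟩
  obtain ⟨y, hy⟩ : ∃ y, ∀ w ∉ insert x A, w = y ∨ (y ∉ insert x A ∧ r.le w y) := by
    rcases (insert x A)ᶜ.eq_empty_or_nonempty with h | h
    · exact ⟨x, fun w hw => (h ▸ hw : w ∈ (∅ : Set O)).elim⟩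
    · obtain ⟨y, hy, hyb⟩ := exists_best r _ h
      exact ⟨y, fun w hw => Or.inr ⟨hy, hyb w hw⟩⟩
  have key : ∀ t, (μ t d = x ∧ ∃ z, μ t '' S = insert z A) ∨
      (μ t d = y ∧ μ t '' S = insert x A) := by
    intro t
    obtain ⟨z, hz⟩ := hA t
    have h1 := hle t
    have h2 := hnot t
    rw [hz] at h1 h2
    by_cases hzx : z = x
    · subst hzx
      refine Or.inr ⟨?_, hz⟩
      rcases hy _ h2 with h | ⟨hyA, h⟩
      · exact h
      · exact r.le_antisymm _ _ h (h1 _ hyA)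
    · refine Or.inl ⟨r.le_antisymm _ _ (hxb _ fun h => h2 (Or.inr h)) (h1 _ ?_), z, hz⟩
      rintro (h | h)
      · exact hzx h.symm
      · exact hx h
  refine ⟨⟨insert x A, fun t => ?_⟩, x, y, fun t => ?_⟩
  · rcases key t with ⟨h, z, hz⟩ | ⟨h, hz⟩
    · exact ⟨z, by rw [Set.image_insert_eq, h, hz, Set.insert_comm]⟩
    · exact ⟨y, by rw [Set.image_insert_eq, h, hz]⟩
  · rcases key t with ⟨h, -⟩ | ⟨h, -⟩
    exacts [Or.inl h, Or.inr h]

/-- Agent `i` comes before the other agents of `S`, and her preferences, varying with `t`, have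
had no effect but to add one varying object to a fixed set of objects taken; each of the other
agents gets one of two objects. -/
def LimitedInfluence {ι : Type*} (μ : ι → N ≃ O) (i : N) (S : Set N) : Prop :=
  (∃ A, ∀ t, ∃ x, μ t '' S = insert x A) ∧
    ∀ b ∈ S, b ≠ i → ∃ x y, ∀ t, μ t b = x ∨ μ t b = y

theorem LimitedInfluence.insert [Finite O] {ι : Type*} [Nonempty ι] {μ : ι → N ≃ O} {i : N}
    {S : Set N} (h : LimitedInfluence μ i S) {d : N} (hd : d ∉ S) (r : LinearOrder O)
    (hr : ∀ t, ∀ b ∉ S, r.le (μ t b) (μ t d)) : LimitedInfluence μ i (insert d S) := by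
  obtain ⟨⟨A, hA⟩, h2⟩ := h
  obtain ⟨h3, h4⟩ := exists_two_choices hd r hA hr
  refine ⟨h3, ?_⟩
  rintro b (rfl | hb) hbi
  · exact h4
  · exact h2 b hb hbi

theorem ncard_range_le_two {ι : Type*} {f : ι → O} {x y : O} (h : ∀ t, f t = x ∨ f t = y) :
    (Set.range f).ncard ≤ 2 := by
  refine (Set.ncard_le_ncard (t := {x, y}) ?_ (Set.toFinite _)).trans ?_
  · rintro _ ⟨t, rfl⟩
    exact h t
  · simpa using Set.ncard_insert_le x {y}

/-- Agent `i` is treated as choosing first if she is a pole, and at her place in the ordering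
otherwise. -/
theorem ncard_menu_le_two [Finite N] [DecidableEq N] {n : ℕ} {e : Fin n ≃ N}
    {c : OwnershipStructure N O} {φ : Rule N O} {i₁ i₂ : N} (hc : c.IsPolarSerial e i₁ i₂)
    (hφ : c.Implements φ) {i j : N} (hij : i ≠ j) (R : Profile N O) :
    (φ.menu i j R).ncard ≤ 2 := by
  have hfin : Finite O := Finite.of_equiv N (φ R)
  rw [OwnershipStructure.implements_iff] at hφ
  set μ : LinearOrder O → N ≃ O := fun r => φ (Function.update R i r) with hμ
  have : Nonempty (LinearOrder O) := ⟨R i⟩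
  have hcomp : ∀ r, c.Completes (Function.update R i r) (μ r) ∅ := fun r => hφ _
  -- After `i` has left, all remaining agents choose in turn.
  have hrest : ∀ m, 2 ≤ m → i ∈ initial e m → LimitedInfluence μ i (initial e m) →
      ∀ k, m ≤ k → k ≤ n → LimitedInfluence μ i (initial e k) := by
    intro m hm him h k hk
    induction k, hk using Nat.le_induction with
    | base => exact fun _ => h
    | succ k hk ih =>
      intro hkn
      have hstep := initial_succ e ⟨k, hkn⟩
      simp only at hstep
      rw [hstep]
      refine (ih (by omega)).insert (by simp [mem_initial]) (R (e ⟨k, hkn⟩)) fun r => ?_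
      have := hc.le_apply (hcomp r) ⟨k, hkn⟩ (by simp only; omega)
      rwa [Function.update_of_ne] at this
      rintro rfl
      simp only [mem_initial, Equiv.symm_apply_apply] at him
      omega
  suffices ∃ x y, ∀ r, μ r j = x ∨ μ r j = y by
    obtain ⟨x, y, h⟩ := this
    exact ncard_range_le_two h
  have hfinish : ∀ m, 2 ≤ m → m ≤ n → i ∈ initial e m → LimitedInfluence μ i (initial e m) →
      ∃ x y, ∀ r, μ r j = x ∨ μ r j = y := fun m hm hmn him h =>
    (hrest m hm him h n hmn le_rfl).2 j (by simp [initial_eq_univ]) hij.symm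
  have hstart : ∀ i', c.HasPoles i i' → LimitedInfluence μ i {i, i'} := by
    intro i' hp
    rw [Set.pair_comm]
    refine LimitedInfluence.insert (S := {i})
      ⟨⟨∅, fun r => ⟨μ r i, by simp⟩⟩, fun b hb hbi => (hbi hb).elim⟩
      (by simpa using hp.ne.symm) (R i') fun r => ?_
    have := (hp.poleOutcome (hcomp r)).le_apply_right
    rwa [Function.update_of_ne hp.ne.symm] at this
  have h12 := initial_two hc.left_pos hc.right_pos
  have hn : 2 ≤ n := by
    have := (e.symm i₂).isLt
    have := hc.right_pos
    omega
  by_cases hi : i ∈ initial e 2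
  · refine hfinish 2 le_rfl hn hi ?_
    rw [h12] at hi ⊢
    rcases hi with rfl | rfl
    · exact hstart _ hc.hasPoles
    · rw [Set.pair_comm]
      exact hstart _ hc.hasPoles.symm
  · set m := e.symm i with hm
    have hm2 : 2 ≤ m.val := not_lt.1 hi
    have hem : e m = i := by simp [hm]
    have him : i ∉ initial e m := by simp [mem_initial, hm]
    have hconst : ∀ r, ∀ a ∈ initial e m, μ r a = μ (R i) a := by
      intro r a ha
      refine ((hc.reaches (hcomp r) hm2 m.isLt.le hc rfl fun b hb => ?_).agrees
        (hcomp (R i))).1 a ha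
      have hbi : b ≠ i := by rintro rfl; exact him hb
      rw [Function.update_of_ne hbi, Function.update_of_ne hbi]
    refine hfinish (m + 1) (by omega) m.isLt (by simp [mem_initial, hm]) ?_
    rw [initial_succ, hem]
    refine ⟨⟨μ (R i) '' initial e m, fun r => ⟨μ r i, ?_⟩⟩, ?_⟩
    · rw [Set.image_insert_eq, Set.image_congr (hconst r)]
    · rintro b (rfl | hb) hbi
      · exact (hbi rfl).elim
      · exact ⟨μ (R i) b, μ (R i) b, fun r => Or.inl (hconst r b hb)⟩

end Assignment

/-! ### Preference profiles for three agents and three objects -/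

namespace Assignment

variable {N O : Type*}

open Classical in
/-- The position of an object, from below, in an order with `a`, `b`, `c` on top. -/
noncomputable def topThreeRank [Finite O] (a b c o : O) : ℕ :=
  if o = a then Nat.card O + 2 else if o = b then Nat.card O + 1 else if o = c then Nat.card O
  else Finite.equivFin O o

theorem topThreeRank_injective [Finite O] (a b c : O) :
    Function.Injective (topThreeRank a b c) := by
  intro o p h
  have h1 := (Finite.equivFin O o).isLt
  have h2 := (Finite.equivFin O p).isLt
  unfold topThreeRank at h
  split_ifs at h <;> first | exact (Finite.equivFin O).injective (Fin.ext h) | omega | simp_all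

/-- A linear order of the objects with `a`, `b`, `c` on top, in this order. If the three coincide,
only `a` is known to be on top. -/
@[reducible] noncomputable def topThree [Finite O] (a b c : O) : LinearOrder O :=
  LinearOrder.lift' (topThreeRank a b c) (topThreeRank_injective a b c)

theorem topThree_le [Finite O] {a b c o p : O} :
    (topThree a b c).le o p ↔ topThreeRank a b c o ≤ topThreeRank a b c p := Iff.rfl

theorem topThree_first [Finite O] (a b c o : O) : (topThree a b c).le o a := by
  have h1 := (Finite.equivFin O o).isLt
  rw [topThree_le]
  unfold topThreeRank
  split_ifs <;> first | omega | simp_all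

theorem topThree_second [Finite O] {a o : O} (b c : O) (ha : o ≠ a) : (topThree a b c).le o b := by
  have h1 := (Finite.equivFin O o).isLt
  rw [topThree_le]
  unfold topThreeRank
  split_ifs <;> first | omega | simp_all

theorem topThree_third [Finite O] {a b o : O} (c : O) (ha : o ≠ a) (hb : o ≠ b) :
    (topThree a b c).le o c := by
  have h1 := (Finite.equivFin O o).isLt
  rw [topThree_le]
  unfold topThreeRank
  split_ifs <;> first | omega | simp_all

theorem topThree_swap_left [Finite O] {a b c o p : O} (ho : o ≠ a) (hp : p ≠ a) :
    (topThree a b c).le o p ↔ (topThree b a c).le o p := by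
  have h1 := (Finite.equivFin O o).isLt
  have h2 := (Finite.equivFin O p).isLt
  rw [topThree_le, topThree_le]
  unfold topThreeRank
  split_ifs <;> first | contradiction | omega

theorem topThree_swap_right [Finite O] {a b c o p : O} (ho : o ≠ b) (hp : p ≠ b) :
    (topThree a b c).le o p ↔ (topThree a c b).le o p := by
  have h1 := (Finite.equivFin O o).isLt
  have h2 := (Finite.equivFin O p).isLt
  rw [topThree_le, topThree_le]
  unfold topThreeRank
  split_ifs <;> first | contradiction | omega

/-- The agents `j` and `k` have the preferences `r` and `s`, agent `i` has `v` on top, and each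
other agent `l` has `β l` on top. -/
@[reducible] noncomputable def trioProfile [Finite O] [DecidableEq N] (β : N ≃ O) (i j k : N)
    (r s : LinearOrder O) (v : O) : Profile N O :=
  Function.update (fun l => if l = j then r else if l = k then s else topThree (β l) (β l) (β l)) i
    (topThree v v v)

section trioProfile

variable [Finite O] [DecidableEq N] {β : N ≃ O} {i j k l : N} {r s : LinearOrder O} {v : O}

theorem trioProfile_i : trioProfile β i j k r s v i = topThree v v v := by
  simp [trioProfile]

theorem trioProfile_j (hij : i ≠ j) : trioProfile β i j k r s v j = r := by
  simp [trioProfile, hij.symm]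

theorem trioProfile_k (hik : i ≠ k) (hjk : j ≠ k) : trioProfile β i j k r s v k = s := by
  simp [trioProfile, hik.symm, hjk.symm]

theorem trioProfile_other (hi : l ≠ i) (hj : l ≠ j) (hk : l ≠ k) :
    trioProfile β i j k r s v l = topThree (β l) (β l) (β l) := by
  simp [trioProfile, hi, hj, hk]

theorem trioProfile_comm (hjk : j ≠ k) : trioProfile β i j k r s v = trioProfile β i k j s r v := by
  unfold trioProfile
  congr 1
  funext l
  by_cases hj : l = j
  · simp [hj, hjk]
  · simp [hj]

end trioProfile

theorem exists_rearrangement [DecidableEq N] (β : N ≃ O) {i j k : N} (hij : i ≠ j) (hik : i ≠ k)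
    (hjk : j ≠ k) {a b d : N} (hab : a ≠ b) (had : a ≠ d) (hbd : b ≠ d)
    (ha : a = i ∨ a = j ∨ a = k) (hb : b = i ∨ b = j ∨ b = k) (hd : d = i ∨ d = j ∨ d = k) :
    ∃ ν : N ≃ O, ν i = β a ∧ ν j = β b ∧ ν k = β d ∧
      ∀ l, l ≠ i → l ≠ j → l ≠ k → ν l = β l := by
  suffices ∃ π : Equiv.Perm N, π i = a ∧ π j = b ∧ π k = d ∧
      ∀ l, l ≠ i → l ≠ j → l ≠ k → π l = l by
    obtain ⟨π, h1, h2, h3, h4⟩ := this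
    refine ⟨π.trans β, ?_⟩
    simp only [Equiv.trans_apply, h1, h2, h3, true_and]
    exact fun l hi hj hk => by rw [h4 l hi hj hk]
  rcases ha with ha | ha | ha <;> rcases hb with hb | hb | hb <;>
    first
    | exact absurd (ha.trans hb.symm) hab
    | rcases hd with hd | hd | hd <;>
        first
        | exact absurd (ha.trans hd.symm) had
        | exact absurd (hb.trans hd.symm) hbd
        | skip
  · refine ⟨1, ?_⟩
    grind [Equiv.Perm.one_apply]
  · refine ⟨Equiv.swap j k, ?_⟩
    grind
  · refine ⟨Equiv.swap i j, ?_⟩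
    grind
  · refine ⟨Equiv.swap i j * Equiv.swap j k, ?_⟩
    grind [Equiv.Perm.mul_apply]
  · refine ⟨Equiv.swap i k * Equiv.swap k j, ?_⟩
    grind [Equiv.Perm.mul_apply]
  · refine ⟨Equiv.swap i k, ?_⟩
    grind

/-- If the menus have at most two elements, then three reports of agent `i` cannot lead to three
different objects for `j`. -/
theorem Rule.eq_of_ncard_menu_le_two [Finite O] [DecidableEq N] {φ : Rule N O} {i j : N}
    {R : Profile N O} (h : (φ.menu i j R).ncard ≤ 2) (r s t : LinearOrder O)
    (hrs : φ (Function.update R i r) j ≠ φ (Function.update R i s) j)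
    (hrt : φ (Function.update R i r) j ≠ φ (Function.update R i t) j)
    (hst : φ (Function.update R i s) j ≠ φ (Function.update R i t) j) : False := by
  classical
  have h3 : ({φ (Function.update R i r) j, φ (Function.update R i s) j,
      φ (Function.update R i t) j} : Set O).ncard = 3 :=
    Set.ncard_eq_three.2 ⟨_, _, _, hrs, hrt, hst, rfl⟩
  have hsub : ({φ (Function.update R i r) j, φ (Function.update R i s) j,
      φ (Function.update R i t) j} : Set O) ⊆ φ.menu i j R := by
    rintro _ (rfl | rfl | rfl) <;> exact Set.mem_range_self _
  have := Set.ncard_le_ncard hsub (Set.toFinite _)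
  omega

end Assignment

/-! ### Competition after a set of dictators has left -/

namespace Assignment

variable {N O : Type*} [Finite O] [DecidableEq N]
  {c : OwnershipStructure N O} {φ : Rule N O} {β : N ≃ O} {i j k : N} {r s : LinearOrder O}

namespace OwnershipStructure

/-- The trading-cycles outcome is efficient, so at a trio profile an assignment to `i`, `j`, `k` of
the objects `β i`, `β j`, `β k` that is no worse for `j` and `k` than the outcome is the outcome. -/
theorem trioProfile_apply_eq {R : Profile N O} {v : O} (hR : R = trioProfile β i j k r s v)
    (hφ : c.Completes R (φ R) ∅) (hij : i ≠ j) (hik : i ≠ k) (hjk : j ≠ k) {a b d : N}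
    (hab : a ≠ b) (had : a ≠ d) (hbd : b ≠ d)
    (ha : a = i ∨ a = j ∨ a = k) (hb : b = i ∨ b = j ∨ b = k) (hd : d = i ∨ d = j ∨ d = k)
    (hi : φ R i = β a) (hj : r.le (φ R j) (β b)) (hk : s.le (φ R k) (β d)) :
    φ R j = β b ∧ φ R k = β d := by
  obtain ⟨ν, h1, h2, h3, h4⟩ := exists_rearrangement β hij hik hjk hab had hbd ha hb hd
  have : ν = φ R := by
    refine hφ.eq_of_forall_le (fun a ha => ha.elim) fun l => ?_
    by_cases hli : l = i
    · rw [hli, h1, hi]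
      exact (R i).le_refl _
    by_cases hlj : l = j
    · rw [hlj, h2, hR, trioProfile_j hij, ← hR]
      exact hj
    by_cases hlk : l = k
    · rw [hlk, h3, hR, trioProfile_k hik hjk, ← hR]
      exact hk
    · rw [h4 l hli hlj hlk, hR, trioProfile_other hli hlj hlk]
      exact topThree_first _ _ _ _
  rw [← this]
  exact ⟨h2, h3⟩

/-- When `i` takes `β a`, and `j` and `k` both prefer `β b` to `β d` to the objects outside the
trio, one of them gets `β b` and the other `β d`. -/
theorem trioProfile_apply_or {R : Profile N O} {v : O} (hR : R = trioProfile β i j k r s v)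
    (hφ : c.Completes R (φ R) ∅) (hij : i ≠ j) (hik : i ≠ k) (hjk : j ≠ k) {a b d : N}
    (hab : a ≠ b) (had : a ≠ d) (hbd : b ≠ d)
    (ha : a = i ∨ a = j ∨ a = k) (hb : b = i ∨ b = j ∨ b = k) (hd : d = i ∨ d = j ∨ d = k)
    (hi : φ R i = β a)
    (hr : ∀ o, o ≠ β a → r.le o (β b)) (hr' : ∀ o, o ≠ β a → o ≠ β b → r.le o (β d))
    (hs : ∀ o, o ≠ β a → s.le o (β b)) (hs' : ∀ o, o ≠ β a → o ≠ β b → s.le o (β d)) :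
    (φ R j = β b ∧ φ R k = β d) ∨ (φ R j = β d ∧ φ R k = β b) := by
  have hja := apply_ne_of_apply_eq hi hij
  have hka := apply_ne_of_apply_eq hi hik
  by_cases hkb : φ R k = β b
  · have hjb := apply_ne_of_apply_eq hkb hjk.symm
    exact Or.inr (trioProfile_apply_eq hR hφ hij hik hjk had hab hbd.symm ha hd hb hi
      (hr' _ hja hjb) (hs _ hka))
  · exact Or.inl (trioProfile_apply_eq hR hφ hij hik hjk hab had hbd ha hb hd hi
      (hr _ hja) (hs' _ hka hkb))

theorem trioProfile_menu (hmenu : ∀ R, (φ.menu i j R).ncard ≤ 2)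
    {x y z : O} (hxy : φ (trioProfile β i j k r s x) j ≠ φ (trioProfile β i j k r s y) j)
    (hxz : φ (trioProfile β i j k r s x) j ≠ φ (trioProfile β i j k r s z) j)
    (hyz : φ (trioProfile β i j k r s y) j ≠ φ (trioProfile β i j k r s z) j) : False :=
  Rule.eq_of_ncard_menu_le_two (hmenu _) _ _ _ hxy hxz hyz

/-- Suppose that `i` can choose among `β i`, `β j`, `β k`, and that `k` beats `j` in the competition
for `β k` when `i` takes `β i`. Then, by the bound on the menu of `i` for `j`, agent `k` also
beats `j` in the competition for `β k` when `i` takes `β j`. -/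
theorem wins_of_wins [Finite N] (hφ : ∀ R, c.Completes R (φ R) ∅)
    (hmenu : ∀ R, (φ.menu i j R).ncard ≤ 2) (hij : i ≠ j) (hik : i ≠ k) (hjk : j ≠ k)
    (hr : r = topThree (β k) (β i) (β j)) (hs : s = topThree (β k) (β j) (β i))
    (hi : φ (trioProfile β i j k r s (β i)) i = β i)
    (hj : φ (trioProfile β i j k r s (β j)) i = β j)
    (hk : φ (trioProfile β i j k r s (β k)) i = β k)
    (hwin : φ (trioProfile β i j k r s (β i)) k = β k) :
    φ (trioProfile β i j k r s (β j)) j = β i ∧ φ (trioProfile β i j k r s (β j)) k = β k := by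
  have nij := β.injective.ne hij
  have nik := β.injective.ne hik
  have njk := β.injective.ne hjk
  have r2 : ∀ o, o ≠ β k → r.le o (β i) := fun o ho => hr ▸ topThree_second _ _ ho
  have r3 : ∀ o, o ≠ β k → o ≠ β i → r.le o (β j) := fun o h h' => hr ▸ topThree_third _ h h'
  have s2 : ∀ o, o ≠ β k → s.le o (β j) := fun o ho => hs ▸ topThree_second _ _ ho
  -- When `i` takes `β i`, agent `j` is left with `β j`.
  have h1 : φ (trioProfile β i j k r s (β i)) j = β j := by
    refine (trioProfile_apply_eq rfl (hφ _) hij hik hjk (a := i) (b := j) (d := k) hij hik hjk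
      (by simp) (by simp) (by simp) hi ?_ ?_).1
    · exact r3 _ (apply_ne_of_apply_eq hwin hjk.symm) (apply_ne_of_apply_eq hi hij)
    · rw [hwin]
  -- When `i` takes `β k`, the next choices of `j` and `k` do not conflict.
  have h2 : φ (trioProfile β i j k r s (β k)) j = β i := by
    refine (trioProfile_apply_eq rfl (hφ _) hij hik hjk (a := k) (b := i) (d := j) hik.symm
      hjk.symm hij (by simp) (by simp) (by simp) hk ?_ ?_).1
    · exact r2 _ (apply_ne_of_apply_eq hk hij)
    · exact s2 _ (apply_ne_of_apply_eq hk hik)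
  -- When `i` takes `β j`, both want `β k`, which would be a third object for `j`.
  rcases trioProfile_apply_or rfl (hφ _) hij hik hjk (a := j) (b := k) (d := i) hjk hij.symm
    hik.symm (by simp) (by simp) (by simp) hj (fun o _ => hr ▸ topThree_first _ _ _ o)
    (fun o _ ho => r2 o ho) (fun o _ => hs ▸ topThree_first _ _ _ o)
    (fun o hoj ho => hs ▸ topThree_third _ ho hoj) with h3 | h3
  · refine (trioProfile_menu hmenu (r := r) (s := s) (β := β) (k := k)
      (x := β i) (y := β j) (z := β k) ?_ ?_ ?_).elim
    · rw [h1, h3.1]; exact njk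
    · rw [h1, h2]; exact nij.symm
    · rw [h3.1, h2]; exact nik.symm
  · exact h3

/-- At a trio profile a dictator `i` can choose among the objects of the trio, and the other
dictators keep their objects. The submatching of `S` when `i` has `β d` on top is written with a
swap of `i` and `d`. -/
theorem Dictates.trio [Finite N] {S : Set N} (hS : Dictates c S) (hφ : ∀ R, c.Completes R (φ R) ∅)
    (hi : i ∈ S) (hj : j ∉ S) (hk : k ∉ S) {d : N} (hd : d = i ∨ d ∉ S) {R : Profile N O}
    (hR : R = trioProfile β i j k r s (β d)) :
    φ R i = β d ∧ c.Completes R (φ R) S ∧ part (φ R) S = part ((Equiv.swap i d).trans β) S := by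
  have hreach : c.Reaches R ((Equiv.swap i d).trans β) S := by
    refine hS _ _ fun a ha o => ?_
    rw [hR]
    by_cases hai : a = i
    · subst hai
      rw [trioProfile_i]
      simpa using topThree_first _ _ _ o
    · have haj : a ≠ j := by rintro rfl; exact hj ha
      have hak : a ≠ k := by rintro rfl; exact hk ha
      have had : a ≠ d := by
        rintro rfl
        exact hd.elim hai fun h => h ha
      rw [trioProfile_other hai haj hak]
      simpa [Equiv.swap_apply_of_ne_of_ne hai had] using topThree_first _ _ _ o
  obtain ⟨h1, h2⟩ := hreach.agrees (hφ R)
  exact ⟨by simpa using (h1 i hi).symm, h2, part_congr fun a ha => (h1 a ha).symm⟩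

/-- After a nonempty set of dictators has left, two agents `j` and `k` cannot both own objects. -/
theorem Dictates.not_two_owners [Finite N] {S : Set N} (hS : Dictates c S)
    (hφ : ∀ R, c.Completes R (φ R) ∅)
    (hmenu : ∀ i j, i ≠ j → ∀ R, (φ.menu i j R).ncard ≤ 2)
    (hi : i ∈ S) (hj : j ∉ S) (hk : k ∉ S) (hjk : j ≠ k)
    (hoj : c.owner (part β S) (β j) = j) (hok : c.owner (part β S) (β k) = k) : False := by
  have hij : i ≠ j := by rintro rfl; exact hj hi
  have hik : i ≠ k := by rintro rfl; exact hk hi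
  have hI : part ((Equiv.swap i i).trans β) S = part β S := by simp
  -- First `j` and `k` compete for the object of `k`, then for the object of `j`.
  have win : ∀ {j k : N}, i ≠ j → i ≠ k → j ≠ k → j ∉ S → k ∉ S →
      c.owner (part β S) (β k) = k →
      φ (trioProfile β i j k (topThree (β k) (β i) (β j)) (topThree (β k) (β j) (β i)) (β j)) j
        = β i := by
    intro j k hij hik hjk hj hk hok
    refine (wins_of_wins hφ (hmenu i j hij) hij hik hjk rfl rfl
      (hS.trio hφ hi hj hk (Or.inl rfl) rfl).1 (hS.trio hφ hi hj hk (Or.inr hj) rfl).1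
      (hS.trio hφ hi hj hk (Or.inr hk) rfl).1 ?_).1
    obtain ⟨-, h1, h2⟩ := hS.trio (β := β) (r := topThree (β k) (β i) (β j))
      (s := topThree (β k) (β j) (β i)) hφ hi hj hk (Or.inl rfl) rfl
    rw [hI] at h2
    refine Completes.apply_eq_of_part_eq h1 h2 hk (by simpa) (fun o => ?_) hok
    rw [trioProfile_k hik hjk]
    exact topThree_first _ _ _ _
  have hj1 := win hij hik hjk hj hk hok
  have hk1 := win hik hij hjk.symm hk hj hoj
  -- In the final profile, `j` and `k` prefer each other's object.
  set r := topThree (β k) (β j) (β i) with hr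
  set s := topThree (β j) (β k) (β i) with hs
  -- When `i` has taken the object of `j` or of `k`, its place in their preferences is immaterial.
  have same : ∀ {d : N} {r' s' : LinearOrder O}, (d = j ∨ d = k) →
      (∀ o p, o ≠ β d → p ≠ β d → r'.le o p → r.le o p) →
      (∀ o p, o ≠ β d → p ≠ β d → s'.le o p → s.le o p) →
      φ (trioProfile β i j k r' s' (β d)) = φ (trioProfile β i j k r s (β d)) := by
    intro d r' s' hd hr' hs'
    have hdS : d ∉ S := by rcases hd with rfl | rfl <;> assumption
    obtain ⟨h1, h2, h3⟩ := hS.trio (β := β) (r := r') (s := s') hφ hi hj hk (Or.inr hdS) rfl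
    obtain ⟨h4, h5, h6⟩ := hS.trio (β := β) (r := r) (s := s) hφ hi hj hk (Or.inr hdS) rfl
    refine Completes.unique (S := S) (h2.congr_profile ?_) h5 (part_eq_iff.1 (h3.trans h6.symm))
    intro a ha b hb e he hle
    have hne : ∀ b ∉ S, φ (trioProfile β i j k r' s' (β d)) b ≠ β d := fun b hb =>
      apply_ne_of_apply_eq h1 (by rintro rfl; exact hb hi)
    have hai : a ≠ i := by rintro rfl; exact ha hi
    by_cases haj : a = j
    · subst haj
      rw [trioProfile_j hij] at hle ⊢
      exact hr' _ _ (hne b hb) (hne e he) hle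
    by_cases hak : a = k
    · subst hak
      rw [trioProfile_k hik hjk] at hle ⊢
      exact hs' _ _ (hne b hb) (hne e he) hle
    · rw [trioProfile_other hai haj hak] at hle ⊢
      exact hle
  rw [same (Or.inl rfl) (fun o p ho hp => (topThree_swap_right ho hp).2)
    (fun o p ho hp => (topThree_swap_left ho hp).2)] at hj1
  rw [trioProfile_comm hjk.symm, same (Or.inr rfl)
    (fun o p ho hp => (topThree_swap_left ho hp).2)
    (fun o p ho hp => (topThree_swap_right ho hp).2)] at hk1
  have hj0 : φ (trioProfile β i j k r s (β i)) j = β k := by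
    refine (trioProfile_apply_eq rfl (hφ _) hij hik hjk (a := i) (b := k) (d := j) hik hij hjk.symm
      (by simp) (by simp) (by simp) (hS.trio hφ hi hj hk (Or.inl rfl) rfl).1
      (topThree_first _ _ _ _) (topThree_first _ _ _ _)).1
  have hj2 : φ (trioProfile β i j k r s (β k)) j = β j := by
    have hi2 := (hS.trio (β := β) (r := r) (s := s) hφ hi hj hk (Or.inr hk) rfl).1
    refine (trioProfile_apply_eq rfl (hφ _) hij hik hjk (a := k) (b := j) (d := i) hjk.symm hik.symm
      hij.symm (by simp) (by simp) (by simp) hi2 ?_ ?_).1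
    · exact topThree_second _ _ (apply_ne_of_apply_eq hi2 hij)
    · rw [hk1]
  refine trioProfile_menu (hmenu i j hij) (r := r) (s := s) (β := β) (k := k)
      (x := β i) (y := β j) (z := β k) ?_ ?_ ?_
  · rw [hj0, hj1]; exact β.injective.ne hik.symm
  · rw [hj0, hj2]; exact β.injective.ne hjk.symm
  · rw [hj1, hj2]; exact β.injective.ne hij

/-- The owner of all remaining objects cannot change from `j` to `k` when the dictator `i` swaps
objects with `k`: with the preferences of `wins_of_wins`, agent `j` would beat `k` in one case and
lose in the other. -/
theorem Dictates.not_change_owner [Finite N] {S : Set N} (hS : Dictates c S)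
    (hφ : ∀ R, c.Completes R (φ R) ∅)
    (hmenu : ∀ i j, i ≠ j → ∀ R, (φ.menu i j R).ncard ≤ 2)
    (hi : i ∈ S) (hj : j ∉ S) (hk : k ∉ S) (hjk : j ≠ k)
    (hoj : c.owner (part β S) (β j) = j)
    (hok : c.owner (part ((Equiv.swap i k).trans β) S) (β j) = k) : False := by
  have hij : i ≠ j := by rintro rfl; exact hj hi
  have hik : i ≠ k := by rintro rfl; exact hk hi
  set r := topThree (β j) (β i) (β k)
  set s := topThree (β j) (β k) (β i)
  obtain ⟨hi1, h1, h2⟩ := hS.trio (β := β) (r := r) (s := s) hφ hi hk hj (Or.inl rfl) rfl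
  obtain ⟨hi3, h3, h4⟩ := hS.trio (β := β) (r := r) (s := s) hφ hi hk hj (Or.inr hk) rfl
  have hwin : φ (trioProfile β i k j r s (β i)) j = β j := by
    rw [show (Equiv.swap i i).trans β = β by simp] at h2
    refine Completes.apply_eq_of_part_eq h1 h2 hj (by simpa) (fun o => ?_) hoj
    rw [trioProfile_k hij hjk.symm]
    exact topThree_first _ _ _ _
  have hlose : φ (trioProfile β i k j r s (β k)) k = β j := by
    refine Completes.apply_eq_of_part_eq h3 h4 hk ?_ (fun o => ?_) hok
    · simpa [Equiv.swap_apply_of_ne_of_ne hij.symm hjk]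
    · rw [trioProfile_j hik]
      exact topThree_first _ _ _ _
  have := (wins_of_wins hφ (hmenu i k hik) hik hij hjk.symm rfl rfl hi1 hi3
    (hS.trio hφ hi hk hj (Or.inr hj) rfl).1 hwin).1
  exact hij (β.injective (this.symm.trans hlose))

end OwnershipStructure
end Assignment

/-! ### The next dictator -/

namespace Assignment

variable {N O : Type*} [Finite O] [DecidableEq N]
  {c : OwnershipStructure N O} {φ : Rule N O} {i j k : N}

namespace OwnershipStructure

/-- After a nonempty set of dictators has left, all remaining objects have the same owner. -/
theorem Dictates.owner_eq_owner [Finite N] {S : Set N} (hS : Dictates c S)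
    (hφ : ∀ R, c.Completes R (φ R) ∅)
    (hmenu : ∀ i j, i ≠ j → ∀ R, (φ.menu i j R).ncard ≤ 2) (hi : i ∈ S) (μ : N ≃ O) {a b : N}
    (ha : a ∉ S) (hb : b ∉ S) :
    c.owner (part μ S) (μ a) = c.owner (part μ S) (μ b) := by
  by_contra hne
  set j := c.owner (part μ S) (μ a) with hj
  set k := c.owner (part μ S) (μ b) with hk
  have hjS : j ∉ S := freeAgent_part.1 (c.owner_free _ _ (freeObject_part.2 (by simpa)))
  have hkS : k ∉ S := freeAgent_part.1 (c.owner_free _ _ (freeObject_part.2 (by simpa)))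
  have hij : i ≠ j := by rintro h; exact hjS (h ▸ hi)
  have hik : i ≠ k := by rintro h; exact hkS (h ▸ hi)
  obtain ⟨-, h1, h2⟩ := hS.trio (β := μ) (r := topThree (μ a) (μ a) (μ a))
    (s := topThree (μ b) (μ b) (μ b)) hφ hi hjS hkS (Or.inl rfl) rfl
  rw [show (Equiv.swap i i).trans μ = μ by simp] at h2
  have h3 := h1.apply_eq_of_part_eq h2 hjS (by simpa) (fun o => by
    rw [trioProfile_j hij]; exact topThree_first _ _ _ _) hj.symm
  have h4 := h1.apply_eq_of_part_eq h2 hkS (by simpa) (fun o => by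
    rw [trioProfile_k hik hne]; exact topThree_first _ _ _ _) hk.symm
  exact hS.not_two_owners hφ hmenu hi hjS hkS hne (by rw [h2, h3]) (by rw [h2, h4])

/-- The owner does not change when a dictator takes an unassigned object instead of her own. -/
theorem Dictates.owner_swap_of_mem_of_notMem [Finite N] {S : Set N} (hS : Dictates c S)
    (hφ : ∀ R, c.Completes R (φ R) ∅)
    (hmenu : ∀ i j, i ≠ j → ∀ R, (φ.menu i j R).ncard ≤ 2) (hi : i ∈ S) {q : N} (hq : q ∉ S)
    (μ : N ≃ O) {b : N} (hb : b ∉ S) :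
    c.owner (part ((Equiv.swap i q).trans μ) S) ((Equiv.swap i q).trans μ b) =
      c.owner (part μ S) (μ b) := by
  have key := fun ν a b (ha : a ∉ S) (hb : b ∉ S) => hS.owner_eq_owner hφ hmenu hi ν ha hb
  rw [key _ b q hb hq, key _ b q hb hq]
  by_contra hne
  set ν := (Equiv.swap i q).trans μ with hν
  set k := c.owner (part ν S) (ν q) with hk
  set j := c.owner (part μ S) (μ q) with hj
  have hjS : j ∉ S := freeAgent_part.1 (c.owner_free _ _ (freeObject_part.2 (by simpa)))
  have hkS : k ∉ S := freeAgent_part.1 (c.owner_free _ _ (freeObject_part.2 (by simpa)))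
  have hmem : ∀ {a b : N}, a ∈ S → b ∉ S → a ≠ b := fun ha hb h => hb (h ▸ ha)
  -- Relabel the agents outside `S` so that the object of `q` is that of `k`.
  set β := (Equiv.swap k q).trans μ with hβ
  have hβk : β k = μ q := by simp [hβ]
  have hβμ : part β S = part μ S := part_congr fun a ha => by
    simp [hβ, Equiv.swap_apply_of_ne_of_ne (hmem ha hkS) (hmem ha hq)]
  have hβν : part ((Equiv.swap i k).trans β) S = part ν S := part_congr fun a ha => by
    by_cases hai : a = i
    · simp [hai, hν, hβk]
    · have h1 : Equiv.swap i k a = a := Equiv.swap_apply_of_ne_of_ne hai (hmem ha hkS)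
      have h2 : Equiv.swap i q a = a := Equiv.swap_apply_of_ne_of_ne hai (hmem ha hq)
      have h3 : Equiv.swap k q a = a := Equiv.swap_apply_of_ne_of_ne (hmem ha hkS) (hmem ha hq)
      simp [hν, hβ, h1, h2, h3]
  refine hS.not_change_owner (β := β) hφ hmenu hi hjS hkS (Ne.symm hne) ?_ ?_
  · rw [key β j k hjS hkS, hβμ, hβk]
  · have h1 : β j = (Equiv.swap i k).trans β j := by
      simp [Equiv.swap_apply_of_ne_of_ne (hmem hi hjS).symm (Ne.symm hne)]
    have h2 : (Equiv.swap i k).trans β k = ν q := by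
      simp [hν, hβ, Equiv.swap_apply_of_ne_of_ne (hmem hi hkS) (hmem hi hq)]
    rw [h1, key _ j k hjS hkS, h2, hβν]

theorem Dictates.owner_swap [Finite N] {S : Set N} (hS : Dictates c S)
    (hφ : ∀ R, c.Completes R (φ R) ∅)
    (hmenu : ∀ i j, i ≠ j → ∀ R, (φ.menu i j R).ncard ≤ 2) (hne : S.Nonempty) {p q : N}
    (hpq : p ≠ q) (μ : N ≃ O) {b : N} (hb : b ∉ S) :
    c.owner (part ((Equiv.swap p q).trans μ) S) ((Equiv.swap p q).trans μ b) =
      c.owner (part μ S) (μ b) := by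
  have hmem : ∀ {a b : N}, a ∈ S → b ∉ S → a ≠ b := fun ha hb h => hb (h ▸ ha)
  by_cases hp : p ∈ S <;> by_cases hq : q ∈ S
  · -- Two dictators exchange their objects in three steps, using an unassigned object.
    have : Equiv.swap p q = (Equiv.swap p b).trans ((Equiv.swap q b).trans (Equiv.swap p b)) := by
      have hpb := hmem hp hb
      have hqb := hmem hq hb
      ext a
      simp only [Equiv.trans_apply]
      grind
    rw [this, Equiv.trans_assoc, Equiv.trans_assoc,
      hS.owner_swap_of_mem_of_notMem hφ hmenu hp hb _ hb,
      hS.owner_swap_of_mem_of_notMem hφ hmenu hq hb _ hb,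
      hS.owner_swap_of_mem_of_notMem hφ hmenu hp hb _ hb]
  · exact hS.owner_swap_of_mem_of_notMem hφ hmenu hp hq _ hb
  · rw [Equiv.swap_comm]
    exact hS.owner_swap_of_mem_of_notMem hφ hmenu hq hp _ hb
  · obtain ⟨i, hi⟩ := hne
    have : part ((Equiv.swap p q).trans μ) S = part μ S := part_congr fun a ha => by
      simp [Equiv.swap_apply_of_ne_of_ne (hmem ha hp) (hmem ha hq)]
    rw [this, Equiv.trans_apply]
    refine hS.owner_eq_owner hφ hmenu hi μ ?_ hb
    rw [Equiv.swap_apply_def]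
    split_ifs <;> assumption

/-- After a nonempty set of dictators has left, the owner of all remaining objects does not depend
on which objects the dictators took. -/
theorem Dictates.exists_owner [Finite N] {S : Set N} (hS : Dictates c S)
    (hφ : ∀ R, c.Completes R (φ R) ∅)
    (hmenu : ∀ i j, i ≠ j → ∀ R, (φ.menu i j R).ncard ≤ 2) (hne : S.Nonempty) {b₀ : N}
    (hb₀ : b₀ ∉ S) (μ₀ : N ≃ O) :
    ∃ d ∉ S, ∀ μ : N ≃ O, ∀ b ∉ S, c.owner (part μ S) (μ b) = d := by
  refine ⟨c.owner (part μ₀ S) (μ₀ b₀),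
    freeAgent_part.1 (c.owner_free _ _ (freeObject_part.2 (by simpa))), fun μ b hb => ?_⟩
  obtain ⟨i, hi⟩ := hne
  rw [hS.owner_eq_owner hφ hmenu hi μ hb hb₀]
  have key : ∀ π : Equiv.Perm N,
      c.owner (part (π.trans μ₀) S) (π.trans μ₀ b₀) = c.owner (part μ₀ S) (μ₀ b₀) := by
    intro π
    induction π using Equiv.Perm.swap_induction_on' with
    | one => rfl
    | mul_swap f x y hxy ih =>
      have : (f * Equiv.swap x y).trans μ₀ = (Equiv.swap x y).trans (f.trans μ₀) := rfl
      rw [this, hS.owner_swap hφ hmenu ⟨i, hi⟩ hxy _ hb₀, ih]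
  have hμ : (μ.trans μ₀.symm : Equiv.Perm N).trans μ₀ = μ := by
    ext a; simp
  have := key (μ.trans μ₀.symm)
  rwa [hμ] at this

end OwnershipStructure
end Assignment

/-! ### The poles, the ordering of the agents, and the bi-polar ownership structure -/

namespace Assignment

variable {N O : Type*}

namespace OwnershipStructure

section Poles

variable [Finite N] [Finite O] [DecidableEq N] {c : OwnershipStructure N O} {φ : Rule N O}
  {i j k : N} {R : Profile N O} {μ : N ≃ O} {x y z : O}

/-- Initially at most two agents own objects. If there were three of them, the first could decide
whether the second gets her best object from her, or competes with the third, or must be content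
with her own. -/
theorem not_three_initial_owners (hφ : ∀ R, c.Completes R (φ R) ∅)
    (hmenu : ∀ i j, i ≠ j → ∀ R, (φ.menu i j R).ncard ≤ 2) (μ : N ≃ O) (hij : i ≠ j) (hik : i ≠ k)
    (hjk : j ≠ k) (hx : c.owner ⊥ x = i) (hy : c.owner ⊥ y = j) (hz : c.owner ⊥ z = k) :
    False := by
  obtain ⟨β, rfl, rfl, rfl⟩ : ∃ β : N ≃ O, β i = x ∧ β j = y ∧ β k = z := by
    refine ⟨φ (trioProfile μ i j k (topThree y y y) (topThree z z z) x), ?_, ?_, ?_⟩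
    · refine ((hφ _).apply_eq_of_owner_bot (fun o => ?_) hx).1
      rw [trioProfile_i]
      exact topThree_first _ _ _ _
    · refine ((hφ _).apply_eq_of_owner_bot (fun o => ?_) hy).1
      rw [trioProfile_j hij]
      exact topThree_first _ _ _ _
    · refine ((hφ _).apply_eq_of_owner_bot (fun o => ?_) hz).1
      rw [trioProfile_k hik hjk]
      exact topThree_first _ _ _ _
  set r := topThree (β i) (β k) (β j) with hr
  set s := topThree (β i) (β j) (β k) with hs
  have hi : ∀ v o, (trioProfile β i j k r s v i).le o v := fun v o => by
    rw [trioProfile_i]; exact topThree_first _ _ _ _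
  have hj : ∀ v o, (trioProfile β i j k r s v j).le o (β i) := fun v o => by
    rw [trioProfile_j hij]; exact topThree_first _ _ _ _
  have hk : ∀ v o, (trioProfile β i j k r s v k).le o (β i) := fun v o => by
    rw [trioProfile_k hik hjk]; exact topThree_first _ _ _ _
  -- When `i` takes her own object, `j` and `k` swap theirs.
  have h1 : φ (trioProfile β i j k r s (β i)) j = β k := by
    have h := ((hφ _).apply_eq_of_owner_bot (hi (β i)) hx).1
    exact (trioProfile_apply_eq rfl (hφ _) hij hik hjk (a := i) (b := k) (d := j) hik hij hjk.symm
      (by simp) (by simp) (by simp) h (topThree_second _ _ (apply_ne_of_apply_eq h hij))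
      (topThree_second _ _ (apply_ne_of_apply_eq h hik))).1
  have h2 : φ (trioProfile β i j k r s (β j)) j = β i :=
    ((hφ _).apply_eq_of_swap_bot hij (hi (β j)) (hj (β j)) hy hx).2
  have h3 : φ (trioProfile β i j k r s (β k)) j = β j := by
    obtain ⟨h, h'⟩ := (hφ _).apply_eq_of_swap_bot hik (hi (β k)) (hk (β k)) hz hx
    refine (trioProfile_apply_eq rfl (hφ _) hij hik hjk (a := k) (b := j) (d := i) hjk.symm hik.symm
      hij.symm (by simp) (by simp) (by simp) h (topThree_third _ (apply_ne_of_apply_eq h' hjk.symm)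
      (apply_ne_of_apply_eq h hij)) ?_).1
    rw [h']
  refine trioProfile_menu (hmenu i j hij) (r := r) (s := s) (β := β) (k := k)
      (x := β i) (y := β j) (z := β k) ?_ ?_ ?_
  · rw [h1, h2]; exact β.injective.ne hik.symm
  · rw [h1, h3]; exact β.injective.ne hjk.symm
  · rw [h2, h3]; exact β.injective.ne hij

/-- If initially all objects belong to `i` or `j`, and one to `j`, then `j` owns everything once `i`
has left with an object of her own. If instead some `k` then owned an object, that object would have
been one of `i`, so `i` could take it, or her other object, or the object of `j` in exchange for
it. -/
theorem owner_after_pole (hφ : ∀ R, c.Completes R (φ R) ∅)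
    (hmenu : ∀ i j, i ≠ j → ∀ R, (φ.menu i j R).ncard ≤ 2) (hij : i ≠ j)
    (hbot : ∀ x, c.owner ⊥ x = i ∨ c.owner ⊥ x = j) (hy : c.owner ⊥ y = j)
    (μ : N ≃ O) (hx : c.owner ⊥ (μ i) = i) {b : N} (hb : b ≠ i) :
    c.owner (part μ {i}) (μ b) = j := by
  by_contra hne
  set k := c.owner (part μ {i}) (μ b) with hk
  have hik : i ≠ k := by
    have : k ∉ ({i} : Set N) := freeAgent_part.1 (c.owner_free _ _ (freeObject_part.2 (by simpa)))
    exact fun h => this h.symm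
  have hjk : j ≠ k := Ne.symm hne
  have hpersist : ∀ o, o ≠ μ i → c.owner ⊥ o = j → c.owner (part μ {i}) o = j := by
    intro o ho h
    refine c.persistent ⊥ _ o j (by rw [← part_empty μ]; exact part_mono μ (by simp)) ?_ ?_ h
    · rw [freeObject_part, Set.mem_singleton_iff, Equiv.symm_apply_eq]
      exact ho
    · simpa using hij.symm
  have hz : c.owner ⊥ (μ b) = i := by
    refine (hbot (μ b)).resolve_right fun h => hne ?_
    exact hpersist _ (μ.injective.ne hb) h
  obtain ⟨β, hβi, rfl, hβk⟩ : ∃ β : N ≃ O, β i = μ i ∧ β j = y ∧ β k = μ b := by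
    set R := trioProfile μ i j k (topThree y y y) (topThree (μ b) (μ b) (μ b)) (μ i) with hR
    have h1 := (hφ R).apply_eq_of_owner_bot (i := i) (x := μ i) (fun o => by
      rw [hR, trioProfile_i]
      exact topThree_first _ _ _ _) hx
    have h2 := (hφ R).apply_eq_of_owner_bot (i := j) (x := y) (fun o => by
      rw [hR, trioProfile_j hij]
      exact topThree_first _ _ _ _) hy
    refine ⟨φ R, h1.1, h2.1, h1.2.apply_eq_of_part_eq (ν := μ) ?_ (by simpa using hik.symm)
      (by simpa) (fun o => ?_) hk.symm⟩
    · exact part_congr (by simpa using h1.1)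
    · rw [hR, trioProfile_k hik hjk]
      exact topThree_first _ _ _ _
  have hpart : part β {i} = part μ {i} := part_congr (by simpa)
  rw [← hpart, ← hβk] at hk
  rw [← hβi] at hx
  rw [← hβk] at hz
  set r := topThree (β k) (β i) (β j) with hr
  set s := topThree (β k) (β j) (β i) with hs
  have hi : ∀ v o, (trioProfile β i j k r s v i).le o v := fun v o => by
    rw [trioProfile_i]; exact topThree_first _ _ _ _
  have hswap := (hφ _).apply_eq_of_swap_bot hij (hi (β j)) (fun o => by
    rw [trioProfile_j hij]; exact topThree_first _ _ _ _) hy hz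
  obtain ⟨hown, hcomp⟩ := (hφ _).apply_eq_of_owner_bot (hi (β i)) hx
  have hwin : φ (trioProfile β i j k r s (β i)) k = β k := by
    refine hcomp.apply_eq_of_part_eq (ν := β) (part_congr (by simpa using hown))
      (by simpa using hik.symm) (by simpa using hik.symm) (fun o => ?_) hk.symm
    rw [trioProfile_k hik hjk]
    exact topThree_first _ _ _ _
  have := (wins_of_wins hφ (hmenu i j hij) hij hik hjk hr hs hown hswap.1
    ((hφ _).apply_eq_of_owner_bot (hi (β k)) hz).1 hwin).1
  exact hik (β.injective (this.symm.trans hswap.2))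

/-- If only one agent owns objects initially, then she dictates, and the second pole is the agent
who owns everything after her. -/
theorem exists_hasPoles [Nontrivial N] (hφ : ∀ R, c.Completes R (φ R) ∅)
    (hmenu : ∀ i j, i ≠ j → ∀ R, (φ.menu i j R).ncard ≤ 2) (μ : N ≃ O) :
    ∃ i j, c.HasPoles i j := by
  obtain ⟨a, -⟩ := exists_pair_ne N
  set i := c.owner ⊥ (μ a) with hi
  by_cases h : ∀ x, c.owner ⊥ x = i
  · have hdict : Dictates c (insert i ∅) :=
      dictates_empty.insert (by simp) fun ν b _ => by rw [part_empty]; exact h _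
    rw [insert_empty_eq] at hdict
    obtain ⟨b, hb⟩ := exists_ne i
    obtain ⟨j, hj, hown⟩ := hdict.exists_owner hφ hmenu (by simp) (b₀ := b) (by simpa) μ
    have hij : i ≠ j := fun h => hj h.symm
    exact ⟨i, j, hij, fun x => Or.inl (h x), fun ν _ b hb => hown ν b (by simpa),
      fun ν hν => (hij ((h _).symm.trans hν)).elim⟩
  · push Not at h
    obtain ⟨y, hy⟩ := h
    set j := c.owner ⊥ y with hj
    have hbot : ∀ x, c.owner ⊥ x = i ∨ c.owner ⊥ x = j := by
      intro x
      by_contra! hne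
      exact not_three_initial_owners hφ hmenu μ (Ne.symm hy) (Ne.symm hne.1) (Ne.symm hne.2)
        hi.symm hj.symm rfl
    exact ⟨i, j, Ne.symm hy, hbot,
      fun ν hν b hb => owner_after_pole hφ hmenu (Ne.symm hy) hbot hj.symm ν hν hb,
      fun ν hν b hb => owner_after_pole hφ hmenu hy (fun x => (hbot x).symm) hi.symm ν hν hb⟩

theorem HasPoles.exists_isPolarSerial {n : ℕ} (e₀ : Fin n ≃ N) (hc : c.HasPoles i j)
    (hφ : ∀ R, c.Completes R (φ R) ∅)
    (hmenu : ∀ i j, i ≠ j → ∀ R, (φ.menu i j R).ncard ≤ 2) (μ : N ≃ O) :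
    ∃ e : Fin n ≃ N, c.IsPolarSerial e i j := by
  have hn : 2 ≤ n := by
    have h1 := (e₀.symm i).isLt
    have h2 := (e₀.symm j).isLt
    have h3 : (e₀.symm i).val ≠ (e₀.symm j).val := fun h => hc.ne (e₀.symm.injective (Fin.ext h))
    omega
  -- Put the dictators into their positions one after the other.
  suffices ∀ m, 2 ≤ m → m ≤ n → ∃ e : Fin n ≃ N, (e.symm i).val = 0 ∧ (e.symm j).val = 1 ∧
      Dictates c (initial e m) ∧ ∀ t : Fin n, 2 ≤ t.val → t.val < m → ∀ μ : N ≃ O,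
        ∀ b ∉ initial e t, c.owner (part μ (initial e t)) (μ b) = e t by
    obtain ⟨e, h1, h2, -, h3⟩ := this n hn le_rfl
    exact ⟨e, hc, h1, h2, fun t ht => h3 t ht t.isLt⟩
  intro m hm
  induction m, hm using Nat.le_induction with
  | base =>
    intro _
    set e₁ := (Equiv.swap ⟨0, by omega⟩ (e₀.symm i)).trans e₀ with he₁
    set e₂ := (Equiv.swap ⟨1, by omega⟩ (e₁.symm j)).trans e₁ with he₂
    have h0 : e₁ ⟨0, by omega⟩ = i := by simp [he₁]
    have hi : e₂ ⟨0, by omega⟩ = i := by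
      rw [he₂, Equiv.trans_apply, Equiv.swap_apply_of_ne_of_ne (by simp), h0]
      rw [Ne, Equiv.eq_symm_apply, h0]
      exact hc.ne
    have hj : e₂ ⟨1, by omega⟩ = j := by simp [he₂]
    have hi' : (e₂.symm i).val = 0 := by rw [← hi, Equiv.symm_apply_apply]
    have hj' : (e₂.symm j).val = 1 := by rw [← hj, Equiv.symm_apply_apply]
    refine ⟨e₂, hi', hj', ?_, fun t h2 h2' => by omega⟩
    rw [initial_two hi' hj']
    exact hc.dictates
  | succ m hm ih =>
    intro hmn
    obtain ⟨e, hi, hj, hdict, htail⟩ := ih (by omega)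
    have hiS : i ∈ initial e m := by rw [mem_initial]; omega
    obtain ⟨d, hd, hown⟩ := hdict.exists_owner hφ hmenu ⟨i, hiS⟩ (b₀ := e ⟨m, hmn⟩)
      (by simp [mem_initial]) μ
    set e' := (Equiv.swap ⟨m, hmn⟩ (e.symm d)).trans e with he'
    have hdm : m ≤ (e.symm d).val := not_lt.1 hd
    have hsame : ∀ t : Fin n, t.val < m → e' t = e t := by
      intro t ht
      rw [he', Equiv.trans_apply, Equiv.swap_apply_of_ne_of_ne]
      · rw [Ne, Fin.ext_iff]; simp only; omega
      · rw [Ne, Fin.ext_iff]; omega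
    have hsymm : ∀ a, (e.symm a).val < m → e'.symm a = e.symm a := by
      intro a ha
      rw [Equiv.symm_apply_eq, hsame _ ha, Equiv.apply_symm_apply]
    have hinit : ∀ t ≤ m, initial e' t = initial e t := by
      intro t ht
      ext a
      simp only [mem_initial]
      constructor
      · intro ha
        have := hsame (e'.symm a) (by omega)
        rw [Equiv.apply_symm_apply] at this
        rwa [this, Equiv.symm_apply_apply]
      · intro ha
        rwa [hsymm a (by omega)]
    have hm' : e' ⟨m, hmn⟩ = d := by simp [he']
    refine ⟨e', by rw [hsymm i (by omega), hi], by rw [hsymm j (by omega), hj], ?_, ?_⟩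
    · have := initial_succ e' ⟨m, hmn⟩
      simp only at this
      rw [this, hinit m le_rfl, hm']
      exact hdict.insert hd hown
    · intro t ht htm
      rw [hinit t (by omega)]
      rcases Nat.lt_succ_iff_lt_or_eq.1 htm with h | h
      · rw [hsame t h]
        exact htail t ht h
      · obtain rfl : t = ⟨m, hmn⟩ := Fin.ext h
        rw [hm']
        exact hown

end Poles

section toBipolar

variable [Finite N] {n : ℕ}

open Classical in
/-- The first unmatched agent in the ordering `e`, and the agent `d` if all agents are matched. -/
noncomputable def firstFree (e : Fin n ≃ N) (d : N) (σ : Submatching N O) : N :=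
  if h : ∃ a, σ.FreeAgent a ∧ ∀ b, σ.FreeAgent b → e.symm a ≤ e.symm b then h.choose else d

theorem firstFree_spec (e : Fin n ≃ N) (d : N) {σ : Submatching N O} {a : N}
    (ha : σ.FreeAgent a) : σ.FreeAgent (firstFree e d σ) ∧
      ∀ b, σ.FreeAgent b → e.symm (firstFree e d σ) ≤ e.symm b := by
  have h : ∃ a, σ.FreeAgent a ∧ ∀ b, σ.FreeAgent b → e.symm a ≤ e.symm b :=
    Set.exists_min_image {a | σ.FreeAgent a} e.symm (Set.toFinite _) ⟨a, ha⟩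
  rw [firstFree, dif_pos h]
  exact h.choose_spec

theorem firstFree_eq {e : Fin n ≃ N} {d : N} {σ : Submatching N O} {a : N} (ha : σ.FreeAgent a)
    (h : ∀ b, σ.FreeAgent b → e.symm a ≤ e.symm b) : firstFree e d σ = a := by
  obtain ⟨h1, h2⟩ := firstFree_spec e d ha
  exact e.symm.injective (le_antisymm (h2 a ha) (h _ h1))

variable {c : OwnershipStructure N O} {e : Fin n ≃ N} {i j : N}

open Classical in
/-- The initial owners of `c` keep their objects as long as both poles are unmatched; afterwards the
first unmatched agent owns everything. -/
noncomputable def IsPolarSerial.toBipolar (hc : c.IsPolarSerial e i j) :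
    OwnershipStructure N O where
  owner σ x := if σ.FreeAgent i ∧ σ.FreeAgent j then c.owner ⊥ x else firstFree e i σ
  owner_free σ x hx := by
    split_ifs with h
    · rcases hc.hasPoles.owner_bot x with hx | hx <;> rw [hx]
      exacts [h.1, h.2]
    · exact (firstFree_spec e i (c.owner_free σ x hx)).1
  persistent σ σ' x a hle hx ha := by
    have hfree : ∀ b, σ'.FreeAgent b → σ.FreeAgent b := by
      intro b hb
      rw [Submatching.FreeAgent, Option.eq_none_iff_forall_ne_some] at hb ⊢
      exact fun y hy => hb y (hle b y hy)
    have h0 := hc.left_pos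
    have h1 := hc.right_pos
    intro hown
    by_cases h' : σ'.FreeAgent i ∧ σ'.FreeAgent j
    · rw [if_pos ⟨hfree _ h'.1, hfree _ h'.2⟩] at hown
      rwa [if_pos h']
    rw [if_neg h']
    refine firstFree_eq ha fun b hb => ?_
    by_cases h : σ.FreeAgent i ∧ σ.FreeAgent j
    · -- The owner `a` is a pole, and the other pole has been matched.
      rw [if_pos h] at hown
      rcases hc.hasPoles.owner_bot x with hx | hx
      · rw [← hown, hx, Fin.le_def, h0]
        exact Nat.zero_le _
      · have haj : a = j := hown.symm.trans hx
        have hbi : b ≠ i := fun hbi => h' ⟨hbi ▸ hb, haj ▸ ha⟩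
        have : (e.symm b).val ≠ (e.symm i).val := fun h => hbi (e.symm.injective (Fin.ext h))
        rw [haj, Fin.le_def]
        omega
    · rw [if_neg h] at hown
      rw [← hown]
      exact (firstFree_spec e i (hfree b hb)).2 b (hfree b hb)

theorem IsPolarSerial.toBipolar_owner_bot (hc : c.IsPolarSerial e i j) :
    hc.toBipolar.owner ⊥ = c.owner ⊥ :=
  funext fun _ => if_pos ⟨rfl, rfl⟩

theorem IsPolarSerial.toBipolar_isBipolar (hc : c.IsPolarSerial e i j) :
    hc.toBipolar.IsBipolar e := by
  have h0 := hc.left_pos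
  have h1 := hc.right_pos
  refine ⟨fun x => ?_, ?_⟩
  · rw [hc.toBipolar_owner_bot]
    rcases hc.hasPoles.owner_bot x with hx | hx <;> rw [hx] <;> omega
  · rintro σ ⟨m, hm, hmσ⟩ x - k hk
    have hnot : ¬ (σ.FreeAgent i ∧ σ.FreeAgent j) := by
      rintro ⟨hi, hj⟩
      rcases (by omega : m.val = (e.symm i).val ∨ m.val = (e.symm j).val) with h | h
      · rw [Fin.ext h, Equiv.apply_symm_apply] at hmσ
        exact hmσ hi
      · rw [Fin.ext h, Equiv.apply_symm_apply] at hmσ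
        exact hmσ hj
    have hown : hc.toBipolar.owner σ x = firstFree e i σ := if_neg hnot
    rw [hown]
    constructor
    · intro h
      refine firstFree_eq hk fun b hb => ?_
      rw [Equiv.symm_apply_apply]
      exact h _ (by rwa [Equiv.apply_symm_apply])
    · intro h l hl
      have := (firstFree_spec e i hk).2 _ hl
      rwa [h, Equiv.symm_apply_apply, Equiv.symm_apply_apply] at this

theorem IsPolarSerial.toBipolar_implements {φ : Rule N O} (hc : c.IsPolarSerial e i j)
    (hφ : c.Implements φ) : hc.toBipolar.Implements φ := by
  rw [implements_iff] at hφ ⊢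
  intro R
  have hn : 2 ≤ n := by
    have := (e.symm j).isLt
    have := hc.right_pos
    omega
  obtain ⟨hp, h0, h1, ht⟩ := hc.toBipolar_isBipolar.isPolarSerial hn
  have hi : e ⟨0, by omega⟩ = i := by
    rw [← Equiv.eq_symm_apply]
    exact Fin.ext hc.left_pos.symm
  have hj : e ⟨1, by omega⟩ = j := by
    rw [← Equiv.eq_symm_apply]
    exact Fin.ext hc.right_pos.symm
  rw [hi] at hp h0
  rw [hj] at hp h1
  have := hc.reaches (hφ R) hn le_rfl ⟨hp, h0, h1, ht⟩ hc.toBipolar_owner_bot fun _ _ => rfl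
  rw [initial_eq_univ] at this
  exact this.completes .univ

end toBipolar
end OwnershipStructure
end Assignment

theorem mainTheorem2 {N O : Type*} [Fintype N] [DecidableEq N] [Fintype O]
    (hcard : Fintype.card N = Fintype.card O)
    (φ : Assignment.Rule N O) (hφ : φ.IsHierarchicalExchange) :
    φ.IsBipolarSerialDictatorship ↔
      ∀ (i j : N), i ≠ j → ∀ R : Assignment.Profile N O, (φ.menu i j R).ncard ≤ 2 := by
  constructor
  · rintro ⟨c, e, hc, hφc⟩ i j hij R
    have hn : 2 ≤ Fintype.card N := Fintype.one_lt_card_iff.2 ⟨i, j, hij⟩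
    exact Assignment.ncard_menu_le_two (hc.isPolarSerial hn) hφc hij R
  · intro hmenu
    obtain ⟨c, hc⟩ := hφ
    rcases Nat.lt_or_ge 1 (Fintype.card N) with hn | hn
    · have : Nontrivial N := Fintype.one_lt_card_iff_nontrivial.1 hn
      have μ : N ≃ O := Fintype.equivOfCardEq hcard
      have hcomp := Assignment.OwnershipStructure.implements_iff.1 hc
      obtain ⟨i, j, hpoles⟩ :=
        Assignment.OwnershipStructure.exists_hasPoles hcomp hmenu μ
      obtain ⟨e, he⟩ := hpoles.exists_isPolarSerial (Fintype.equivFin N).symm hcomp hmenu μ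
      exact ⟨he.toBipolar, e, he.toBipolar_isBipolar, he.toBipolar_implements hc⟩
    · exact ⟨c, (Fintype.equivFin N).symm, c.isBipolar_of_le_one _ hn, hc⟩
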